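/- Let $n\ge 1$. Let $\Gamma_n=\mathbf s(\overline{\mathbb D}^n)\subset\mathbb C^n$ be the symmetrized $n$-disc, where $\mathbf s=(s_1,\dots,s_n)$ and $s_i$ is the elementary symmetric polynomial of degree $i$ in $n$ variables ($\Gamma_0$ is the one-point set $\mathbb C^0$). Let $b\Gamma_n$ be its distinguished boundary, i.e. the Shilov boundary of the algebra of functions that are continuous on $\Gamma_n$ and holomorphic in its interior. Operators are bounded linear operators on complex Hilbert spaces. A commuting $n$-tuple $(S_1,\dots,S_n)$ of operators is a $\Gamma_n$-contraction if $\|p(S_1,\dots,S_n)\|\le\sup_{\Gamma_n}|p|$ for every $p\in\mathbb C[z_1,\dots,z_n]$. It is a $\Gamma_n$-unitary if all $S_i$ are normal and the joint spectrum of $(S_1,\dots,S_n)$ is contained in $b\Gamma_n$. It is a $\Gamma_n$-isometry if it is the restriction of a $\Gamma_n$-unitary, acting on a Hilbert space containing the given one, to a joint invariant subspace. It is a pure $\Gamma_n$-isometry if moreover $S_n$ is a pure isometry, i.e. an isometry $V$ on $\mathcal H$ with $\bigcap_{k\ge0}V^k\mathcal H=\{0\}$. For a Hilbert space $\mathcal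 E$, let $\mathcal L(\mathcal E)$ be the algebra of operators on $\mathcal E$, let $H^2(\mathcal E)$ be the Hardy space of functions $f(z)=\sum_{k\ge0}a_kz^k$ on $\mathbb D$ with $a_k\in\mathcal E$ and $\|f\|^2=\sum_k\|a_k\|^2<\infty$, and let $H^\infty\mathcal L(\mathcal E)$ be the space of bounded analytic $\mathcal L(\mathcal E)$-valued functions on $\mathbb D$. $M_\Phi$ denotes the operator $(M_\Phi f)(z)=\Phi(z)f(z)$ on $H^2(\mathcal E)$. **Theorem.** Let $S_1,\dots,S_n$ be commuting operators on a separable Hilbert space $\mathcal H$. Then $(S_1,\dots,S_n)$ is a pure $\Gamma_n$-isometry if and only if there exist a separable Hilbert space $\mathcal E$, a unitary operator $U:\mathcal H\to H^2(\mathcal E)$, functions $\Phi_1,\dots,\Phi_{n-1}\in H^\infty\mathcal L(\mathcal E)$ and operators $A_1,\dots,A_{n-1}\in\mathcal L(\mathcal E)$ such that (i) $S_i=U^*M_{\Phi_i}U$ for $1\le i\le n-1$, and $S_n=U^*M_zU$; (ii) $(\gamma_1\Phi_1(z),\dots,\gamma_{n-1}\Phi_{n-1}(z))$ is a $\Gamma_{n-1}$-contraction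 for all $z\in\mathbb T$, where $\gamma_i=\frac{n-i}{n}$; (iii) $\Phi_i(z)=A_i+A_{n-i}^*z$ for $1\le i\le n-1$ and $|z|\le1$ (for $|z|=1$ this is the boundary value of $\Phi_i$); (iv) $[A_i,A_j]=0$ and $[A_i,A_{n-j}^*]=[A_j,A_{n-i}^*]$ for $1\le i,j\le n-1$, where $[P,Q]=PQ-QP$. -/

import Mathlib

universe u

noncomputable section

namespace SymmetrizedDisc

/-! ### The symmetrized polydisc and its distinguished boundary -/

/-- The symmetrization map of `ℂⁿ`. Coordinates are indexed by `Fin n = {0, …, n - 1}`, so the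
coordinate with index `i` is the elementary symmetric function of degree `i + 1`. -/
def symmetrization (n : ℕ) (z : Fin n → ℂ) : Fin n → ℂ :=
  fun i => ∑ t ∈ Finset.powersetCard ((i : ℕ) + 1) Finset.univ, ∏ j ∈ t, z j

/-- The (closed) symmetrized `n`-disc `Γ_n`, the image of the closed unit polydisc. -/
def Gamma (n : ℕ) : Set (Fin n → ℂ) :=
  symmetrization n '' {z | ∀ i, ‖z i‖ ≤ 1}

/-- The algebra of functions that are continuous on `K` and holomorphic in its interior. (Only the
values on `K` are relevant.) -/
def InDiscAlgebra {n : ℕ} (K : Set (Fin n → ℂ)) (f : (Fin n → ℂ) → ℂ) : Prop :=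
  ContinuousOn f K ∧ DifferentiableOn ℂ f (interior K)

/-- `B` is a closed boundary of the algebra of `K`: every function of the algebra has its
supremum over `K` attained on the closed set `B ⊆ K`. -/
def IsClosedBoundary {n : ℕ} (K B : Set (Fin n → ℂ)) : Prop :=
  B ⊆ K ∧ IsClosed B ∧ ∀ f, InDiscAlgebra K f → ∀ x ∈ K, ∃ y ∈ B, ‖f x‖ ≤ ‖f y‖

/-- The Shilov boundary: the smallest closed boundary, that is, the intersection of all of them. -/
def shilovBoundary {n : ℕ} (K : Set (Fin n → ℂ)) : Set (Fin n → ℂ) :=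
  ⋂₀ {B | IsClosedBoundary K B}

/-- The distinguished boundary `bΓ_n`. -/
def distinguishedBoundary (n : ℕ) : Set (Fin n → ℂ) :=
  shilovBoundary (Gamma n)

/-! ### Tuples of operators -/

section Operators

variable {H : Type u} [NormedAddCommGroup H] [InnerProductSpace ℂ H]

/-- The value `p(S_1, …, S_n)` of a polynomial at a (commuting) tuple of operators: a monomial
is evaluated as the product of the powers of the `S_i` in increasing order of the index. -/
def polyEval {n : ℕ} (p : MvPolynomial (Fin n) ℂ) (S : Fin n → H →L[ℂ] H) : H →L[ℂ] H :=
  ∑ m ∈ p.support, p.coeff m • (List.ofFn fun i => S i ^ m i).prod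

/-- `S` is a `Γ_n`-contraction: a commuting tuple having `Γ_n` as a spectral set. -/
def IsGammaContraction {n : ℕ} (S : Fin n → H →L[ℂ] H) : Prop :=
  (∀ i j, Commute (S i) (S j)) ∧
    ∀ p : MvPolynomial (Fin n) ℂ,
      ‖polyEval p S‖ ≤ sSup ((fun z => ‖MvPolynomial.eval z p‖) '' Gamma n)

/-- A pure isometry: an isometry `V` with `⋂ₖ Vᵏ H = {0}` (one without unitary part). -/
def IsPureIsometry (V : H →L[ℂ] H) : Prop :=
  Isometry V ∧ (⨅ k : ℕ, (V ^ k).toLinearMap.range) = ⊥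

/-- The unital `C*`-algebra generated by a tuple of operators. -/
def cstar [CompleteSpace H] {n : ℕ} (S : Fin n → H →L[ℂ] H) : StarSubalgebra ℂ (H →L[ℂ] H) :=
  (StarAlgebra.adjoin ℂ (Set.range S)).topologicalClosure

theorem mem_cstar [CompleteSpace H] {n : ℕ} (S : Fin n → H →L[ℂ] H) (i : Fin n) : S i ∈ cstar S :=
  StarSubalgebra.le_topologicalClosure _ (StarAlgebra.subset_adjoin ℂ _ (Set.mem_range_self i))

/-- The joint spectrum of a commuting tuple of normal operators: the set of the points
`(χ(S_1), …, χ(S_n))`, where `χ` runs through the characters of the commutative `C*`-algebra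
generated by the tuple. -/
def jointSpectrum [CompleteSpace H] {n : ℕ} (S : Fin n → H →L[ℂ] H) : Set (Fin n → ℂ) :=
  {w | ∃ χ : WeakDual.characterSpace ℂ (cstar S), ∀ i, χ ⟨S i, mem_cstar S i⟩ = w i}

/-- `Γ_n`-unitaries. -/
def IsGammaUnitary [CompleteSpace H] {n : ℕ} (S : Fin n → H →L[ℂ] H) : Prop :=
  (∀ i j, Commute (S i) (S j)) ∧ (∀ i, IsStarNormal (S i)) ∧
    jointSpectrum S ⊆ distinguishedBoundary n

/-- `Γ_n`-isometries: restrictions of `Γ_n`-unitaries to joint invariant subspaces. The inclusion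
of `H` into the larger Hilbert space `K` is the isometric embedding `J`. -/
def IsGammaIsometry {n : ℕ} (S : Fin n → H →L[ℂ] H) : Prop :=
  ∃ (K : Type u) (_ : NormedAddCommGroup K) (_ : InnerProductSpace ℂ K) (_ : CompleteSpace K)
    (J : H →ₗᵢ[ℂ] K) (T : Fin n → K →L[ℂ] K),
    IsGammaUnitary T ∧ ∀ i x, T i (J x) = J (S i x)

/-- Pure `Γ_{n+1}`-isometries; the last operator of the tuple has to be a pure isometry. -/
def IsPureGammaIsometry {n : ℕ} (S : Fin (n + 1) → H →L[ℂ] H) : Prop :=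
  IsGammaIsometry S ∧ IsPureIsometry (S (Fin.last n))

end Operators

/-! ### The Hardy space `H²(E)` -/

section Hardy

/-- The open unit disc of the complex plane. -/
abbrev Disc : Type := Metric.ball (0 : ℂ) 1

variable (E : Type u) [NormedAddCommGroup E] [InnerProductSpace ℂ E]

/-- The functions `f : 𝔻 → E` of the form `f(z) = ∑ₖ zᵏ aₖ` with `∑ₖ ‖aₖ‖² < ∞`. -/
def hardySubmodule : Submodule ℂ (Disc → E) where
  carrier := {f | ∃ a : lp (fun _ : ℕ => E) 2, ∀ z : Disc,
    HasSum (fun k : ℕ => (z : ℂ) ^ k • a k) (f z)}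
  add_mem' := by
    rintro f g ⟨a, ha⟩ ⟨b, hb⟩
    refine ⟨a + b, fun z => ?_⟩
    simpa [smul_add] using (ha z).add (hb z)
  zero_mem' := ⟨0, fun z => by simp⟩
  smul_mem' := by
    rintro c f ⟨a, ha⟩
    refine ⟨c • a, fun z => ?_⟩
    simpa [smul_comm c] using (ha z).const_smul c

/-- The Hardy space `H²(E)` of analytic `E`-valued functions on the unit disc whose Taylor
coefficients are square-summable. -/
def HardySpace : Type u := hardySubmodule E

namespace HardySpace

instance : AddCommGroup (HardySpace E) := inferInstanceAs (AddCommGroup (hardySubmodule E))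

instance : Module ℂ (HardySpace E) := inferInstanceAs (Module ℂ (hardySubmodule E))

instance : CoeFun (HardySpace E) (fun _ => Disc → E) := ⟨Subtype.val⟩

variable {E}

theorem exists_taylor (f : HardySpace E) : ∃ a : lp (fun _ : ℕ => E) 2, ∀ z : Disc,
    HasSum (fun k : ℕ => (z : ℂ) ^ k • a k) (f z) :=
  Subtype.prop f

/-- The sequence of Taylor coefficients of a function in `H²(E)`. -/
def taylor (f : HardySpace E) : lp (fun _ : ℕ => E) 2 := (exists_taylor f).choose

theorem hasSum_taylor (f : HardySpace E) (z : Disc) :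
    HasSum (fun k : ℕ => (z : ℂ) ^ k • taylor f k) (f z) :=
  (exists_taylor f).choose_spec z

theorem taylor_unique {f : HardySpace E} {a : lp (fun _ : ℕ => E) 2}
    (ha : ∀ z : Disc, HasSum (fun k : ℕ => (z : ℂ) ^ k • a k) (f z)) : taylor f = a := by
  classical
  let F : ℂ → E := fun z => if h : z ∈ Metric.ball (0 : ℂ) 1 then f ⟨z, h⟩ else 0
  have key : ∀ b : lp (fun _ : ℕ => E) 2,
      (∀ z : Disc, HasSum (fun k : ℕ => (z : ℂ) ^ k • b k) (f z)) →
      HasFPowerSeriesAt F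
        (fun k => ContinuousMultilinearMap.mkPiRing ℂ (Fin k) (b k)) 0 := by
    intro b hb
    refine hasFPowerSeriesAt_iff.2 ?_
    filter_upwards [Metric.ball_mem_nhds (0 : ℂ) one_pos] with z hz
    have := hb ⟨z, hz⟩
    simpa [F, hz, FormalMultilinearSeries.coeff, mem_ball_zero_iff.mp hz] using this
  have h := (key _ (hasSum_taylor f)).eq_formalMultilinearSeries (key _ ha)
  ext k
  have := congrArg (fun p : FormalMultilinearSeries ℂ ℂ E => p.coeff k) h
  simpa [FormalMultilinearSeries.coeff] using this

variable (E) in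
/-- The map from functions to Taylor coefficients, as a linear map. -/
def taylorₗ : HardySpace E →ₗ[ℂ] lp (fun _ : ℕ => E) 2 where
  toFun := taylor
  map_add' f g := taylor_unique fun z => by
    have h : HasSum _ ((f + g : HardySpace E) z) := (hasSum_taylor f z).add (hasSum_taylor g z)
    simpa [smul_add] using h
  map_smul' c f := taylor_unique fun z => by
    have h : HasSum _ ((c • f : HardySpace E) z) := (hasSum_taylor f z).const_smul c
    simpa [smul_comm c] using h

theorem taylor_injective : Function.Injective (taylorₗ E) := fun f g h =>
  Subtype.ext <| funext fun z => (hasSum_taylor f z).unique (by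
    have h' : taylor f = taylor g := h
    rw [h']
    exact hasSum_taylor g z)

variable (E) in
/-- The norm of `H²(E)`: `‖f‖² = ∑ₖ ‖aₖ‖²` for `f(z) = ∑ₖ zᵏ aₖ`. -/
instance : NormedAddCommGroup (HardySpace E) :=
  NormedAddCommGroup.induced _ _ (taylorₗ E) taylor_injective

variable (E) in
/-- The inner product of `H²(E)`: `⟪f, g⟫ = ∑ₖ ⟪aₖ, bₖ⟫` for `f(z) = ∑ₖ zᵏ aₖ` and
`g(z) = ∑ₖ zᵏ bₖ`. -/
instance : InnerProductSpace ℂ (HardySpace E) where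
  norm_smul_le c f := by
    change ‖taylorₗ E (c • f)‖ ≤ ‖c‖ * ‖taylorₗ E f‖
    rw [map_smul]
    exact norm_smul_le c _
  inner f g := inner ℂ (taylorₗ E f) (taylorₗ E g)
  norm_sq_eq_re_inner f := norm_sq_eq_re_inner (𝕜 := ℂ) (taylorₗ E f)
  conj_inner_symm f g := inner_conj_symm (𝕜 := ℂ) (taylorₗ E f) (taylorₗ E g)
  add_left f g h := by
    rw [map_add]
    exact inner_add_left (𝕜 := ℂ) _ _ _
  smul_left f g c := by
    rw [map_smul]
    exact inner_smul_left (𝕜 := ℂ) _ _ _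

theorem norm_eq (f : HardySpace E) : ‖f‖ = ‖taylor f‖ := rfl

theorem inner_eq (f g : HardySpace E) :
    inner ℂ f g = ∑' k : ℕ, inner ℂ (taylor f k) (taylor g k) := rfl

theorem taylor_surjective [CompleteSpace E] : Function.Surjective (taylorₗ E) := by
  intro a
  have hs : ∀ z : Disc, Summable (fun k : ℕ => (z : ℂ) ^ k • a k) := by
    intro z
    have hz : ‖(z : ℂ)‖ < 1 := mem_ball_zero_iff.mp z.2
    refine Summable.of_norm_bounded
      ((summable_geometric_of_lt_one (norm_nonneg _) hz).mul_right ‖a‖) fun k => ?_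
    rw [norm_smul, norm_pow]
    exact mul_le_mul_of_nonneg_left (lp.norm_apply_le_norm (by norm_num) a k) (by positivity)
  exact ⟨⟨fun z => ∑' k : ℕ, (z : ℂ) ^ k • a k, a, fun z => (hs z).hasSum⟩,
    taylor_unique fun z => (hs z).hasSum⟩

variable (E) in
/-- `H²(E)` is isometrically isomorphic to the space of square-summable sequences in `E`. -/
def taylorEquiv [CompleteSpace E] : HardySpace E ≃ₗᵢ[ℂ] lp (fun _ : ℕ => E) 2 where
  toLinearEquiv := LinearEquiv.ofBijective (taylorₗ E) ⟨taylor_injective, taylor_surjective⟩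
  norm_map' _ := rfl

instance [CompleteSpace E] : CompleteSpace (HardySpace E) :=
  (taylorEquiv E).toIsometryEquiv.completeSpace

end HardySpace

/-- `Φ` restricts to an element of `H^∞ L(E)`: it is a bounded analytic operator-valued function
on the open unit disc. -/
def InHInfty {E : Type u} [NormedAddCommGroup E] [InnerProductSpace ℂ E]
    (Φ : ℂ → E →L[ℂ] E) : Prop :=
  DifferentiableOn ℂ Φ (Metric.ball 0 1) ∧ ∃ C : ℝ, ∀ z ∈ Metric.ball (0 : ℂ) 1, ‖Φ z‖ ≤ C

/-- `M` is the multiplication operator `M_Φ` on `H²(E)`: `(M f)(z) = Φ(z) f(z)` on the disc. -/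
def IsMulOperator {E : Type u} [NormedAddCommGroup E] [InnerProductSpace ℂ E]
    (M : HardySpace E →L[ℂ] HardySpace E) (Φ : ℂ → E →L[ℂ] E) : Prop :=
  ∀ (f : HardySpace E) (z : Disc), M f z = Φ z (f z)

/-- The operator `U S U*` on `K`, for an operator `S` on `H` and a unitary `U : H → K`. -/
def conjBy {H K : Type u} [NormedAddCommGroup H] [InnerProductSpace ℂ H]
    [NormedAddCommGroup K] [InnerProductSpace ℂ K] (U : H ≃ₗᵢ[ℂ] K) (S : H →L[ℂ] H) :
    K →L[ℂ] K :=
  (U : H →L[ℂ] K) ∘L S ∘L (U.symm : K →L[ℂ] H)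

end Hardy

end SymmetrizedDisc

end

/-! The proof rests on a description of the distinguished boundary and on two operator models.

*Geometry.* A point `w` of `ℂᴺ`, `N = n + 1`, is identified with the monic polynomial whose roots
are symmetrized by `w` (`rootPoly`, `binaryForm`). Then `Γ_N` consists of the polynomials with roots
in the closed disc, and the distinguished boundary of those with roots on the unit circle
(`distinguishedBoundary_eq`): these form a closed boundary by the maximum modulus principle, and
points with coordinates in the roots of unity lie in every closed boundary by a peak function
argument. The tuple `(γᵢ wᵢ)` corresponds to the normalized derivative (`derivCoords`). So
`(γᵢ wᵢ) ∈ Γ_n` for `w ∈ Γ_N` by the Gauss–Lucas theorem (`derivCoords_mem_Gamma`); conversely,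
Cohn's theorem (`mem_symmetrization_torus`) says that `w` is in the distinguished boundary if
`(γᵢ wᵢ) ∈ Γ_n`, `|w_N| = 1` and `wᵢ = w̄_{N-i} w_N`.

*Necessity.* By Fuglede's theorem a `Γ_N`-unitary `T` generates a commutative `C*`-algebra, and
Gelfand theory turns the properties of the boundary points into `Tᵢ = T*_{N-i} T_N` and
`(γᵢ Tᵢ)` being a `Γ_n`-contraction. Both restrict to `S`. The Wold decomposition of the pure isometry `S_N` maps `H` onto the Hardy space of
its wandering subspace (`woldUnitary`). The relation `Sᵢ = S*_{N-i} S_N` makes `Sᵢ` the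
multiplication by `Aᵢ + z A*_{N-i}`, where `Aᵢ` is the compression of `Sᵢ` to the wandering subspace
(`woldUnitary_commuting_apply`). Point evaluations intertwine polynomials in `S` with polynomials
in the symbols, so that the reproducing kernel bounds the latter (`norm_le_of_apply_eq`), at first
for `|z| < 1` and then, by continuity, for `|z| = 1`.

*Sufficiency.* The operators with the same symbols on `ℓ²(ℤ, E)` form a commuting normal tuple
(`laurentTuple`) that extends `S`. To see that a character `χ` maps it into the distinguished
boundary, Cohn's theorem leaves `(γᵢ χ(Tᵢ)) ∈ Γ_n` to be shown. With `z = χ(T_N)`, the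
inequality `|p(γ χ(T))| ≤ ‖p(γ Φ(z))‖` holds for all polynomials `p`
(`norm_eval_character_le`), because `T - χ(T)` and `T_N - z` are not jointly bounded below, while
`T` and `Φ(z)` agree modulo `T_N - z`. Polynomial convexity of `Γ_n`
(`mem_Gamma_of_forall_norm_eval_le`) completes the argument. -/

noncomputable section

namespace SymmetrizedDisc

section

open Polynomial

/-! ### Vieta's formulas -/

/-- The binary form `aⁿ + ∑ᵢ aⁿ⁻ⁱ bⁱ wᵢ` (with one-based `i`) attached to a point `w`. For
`w = s(z)` it is `∏ⱼ (a + b zⱼ)`. -/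
def binaryForm {R : Type*} [CommRing R] {n : ℕ} (w : Fin n → R) (a b : R) : R :=
  a ^ n + ∑ i : Fin n, a ^ (n - (i + 1)) * b ^ ((i : ℕ) + 1) * w i

theorem prod_add_mul_eq_binaryForm {R : Type*} [CommRing R] {n : ℕ} (z : Fin n → R) (a b : R) :
    ∏ j, (a + b * z j) = binaryForm
      (fun i : Fin n => ∑ t ∈ Finset.powersetCard ((i : ℕ) + 1) Finset.univ, ∏ j ∈ t, z j) a b := by
  simp_rw [add_comm a]
  rw [Finset.prod_add, Finset.sum_powerset]
  rw [Finset.card_univ, Fintype.card_fin, Finset.sum_range_succ', add_comm, binaryForm]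
  congr 1
  · simp
  · rw [← Fin.sum_univ_eq_sum_range (fun i => ∑ t ∈ Finset.powersetCard (i + 1) Finset.univ,
      (∏ i ∈ t, b * z i) * ∏ i ∈ Finset.univ \ t, a)]
    refine Finset.sum_congr rfl fun i _ => ?_
    rw [Finset.mul_sum]
    refine Finset.sum_congr rfl fun t ht => ?_
    rw [Finset.mem_powersetCard] at ht
    rw [Finset.prod_mul_distrib, Finset.prod_const, Finset.prod_const,
      Finset.card_sdiff_of_subset ht.1, ht.2, Finset.card_univ, Fintype.card_fin]
    ring

theorem binaryForm_symmetrization {n : ℕ} (z : Fin n → ℂ) (a b : ℂ) :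
    binaryForm (symmetrization n z) a b = ∏ j, (a + b * z j) :=
  (prod_add_mul_eq_binaryForm z a b).symm

/-- The monic polynomial `∏ⱼ (X - zⱼ)` written in terms of `w = s(z)`. -/
def rootPoly {n : ℕ} (w : Fin n → ℂ) : ℂ[X] := binaryForm (fun i => C (w i)) X (-1)

theorem rootPoly_symmetrization {n : ℕ} (z : Fin n → ℂ) :
    rootPoly (symmetrization n z) = ∏ j, (X - C (z j)) := by
  have := prod_add_mul_eq_binaryForm (fun j => C (z j)) X (-1)
  simp only [neg_mul, one_mul, ← sub_eq_add_neg] at this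
  rw [this, rootPoly]
  congr 1
  ext1 i
  simp [symmetrization]

theorem eval_rootPoly {n : ℕ} (w : Fin n → ℂ) (x : ℂ) :
    (rootPoly w).eval x = binaryForm w x (-1) := by
  simp [rootPoly, binaryForm, eval_finsetSum]

theorem rootPoly_eq {n : ℕ} (w : Fin n → ℂ) :
    rootPoly w = X ^ n + ∑ i : Fin n, C ((-1) ^ ((i : ℕ) + 1) * w i) * X ^ (n - (i + 1)) := by
  rw [rootPoly, binaryForm]
  refine congrArg (X ^ n + ·) (Finset.sum_congr rfl fun i _ => ?_)
  rw [C_mul, C_pow, C_neg, C_1]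
  ring

theorem degree_rootPoly_tail_lt {n : ℕ} (w : Fin n → ℂ) :
    (∑ i : Fin n, C ((-1) ^ ((i : ℕ) + 1) * w i) * X ^ (n - (i + 1)) : ℂ[X]).degree < n := by
  refine (degree_sum_le _ _).trans_lt ?_
  rw [Finset.sup_lt_iff (by exact_mod_cast WithBot.bot_lt_coe n)]
  intro i _
  refine (degree_C_mul_X_pow_le _ _).trans_lt ?_
  have := i.2
  exact_mod_cast (by omega : n - ((i : ℕ) + 1) < n)

theorem rootPoly_monic {n : ℕ} (w : Fin n → ℂ) : (rootPoly w).Monic := by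
  rw [rootPoly_eq]
  exact monic_X_pow_add (degree_rootPoly_tail_lt w)

theorem natDegree_rootPoly {n : ℕ} (w : Fin n → ℂ) : (rootPoly w).natDegree = n := by
  have h : (rootPoly w).degree = n := by
    rw [rootPoly_eq, degree_add_eq_left_of_degree_lt, degree_X_pow]
    rw [degree_X_pow]
    exact degree_rootPoly_tail_lt w
  exact natDegree_eq_of_degree_eq_some h

theorem coeff_rootPoly {n : ℕ} (w : Fin n → ℂ) (i : Fin n) :
    (rootPoly w).coeff (n - (i + 1)) = (-1) ^ ((i : ℕ) + 1) * w i := by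
  have hi := i.2
  rw [rootPoly_eq, coeff_add, coeff_X_pow, if_neg (by omega), zero_add, finsetSum_coeff,
    Finset.sum_eq_single i]
  · rw [coeff_C_mul_X_pow, if_pos rfl]
  · intro j _ hj
    have hj2 := j.2
    have : (j : ℕ) ≠ i := fun h => hj (Fin.ext h)
    rw [coeff_C_mul_X_pow, if_neg (by omega)]
  · simp

theorem rootPoly_injective (n : ℕ) : Function.Injective (rootPoly (n := n)) := by
  intro v w h
  ext i
  have := congrArg (fun p => p.coeff (n - (i + 1))) h
  simp only [coeff_rootPoly] at this
  exact mul_left_cancel₀ (pow_ne_zero _ (by norm_num)) this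

theorem exists_eq_prod_X_sub_C {n : ℕ} {p : ℂ[X]} (hp : p.Monic) (hn : p.natDegree = n) :
    ∃ z : Fin n → ℂ, p = ∏ j, (X - C (z j)) := by
  have hs := (IsAlgClosed.splits p).eq_prod_roots_of_monic hp
  have hc : p.roots.card = n := by rw [← hn, (IsAlgClosed.splits p).natDegree_eq_card_roots]
  obtain ⟨l, hl⟩ := Quot.exists_rep p.roots
  have hl' : (l : Multiset ℂ) = p.roots := hl
  rw [← hl'] at hs hc
  rw [Multiset.coe_card] at hc
  subst hc
  refine ⟨l.get, ?_⟩
  conv_lhs => rw [hs]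
  rw [Multiset.map_coe, Multiset.prod_coe, ← List.prod_ofFn]
  congr 1
  conv_lhs => rw [← List.ofFn_get l]
  rw [List.map_ofFn]
  rfl

theorem symmetrization_last {n : ℕ} (z : Fin (n + 1) → ℂ) :
    symmetrization (n + 1) z (Fin.last n) = ∏ j, z j := by
  have := Finset.powersetCard_self (Finset.univ : Finset (Fin (n + 1)))
  rw [Finset.card_univ, Fintype.card_fin] at this
  rw [symmetrization, Fin.val_last, this, Finset.sum_singleton]

theorem symmetrization_surjective (n : ℕ) : Function.Surjective (symmetrization n) := by
  intro w
  obtain ⟨z, hz⟩ := exists_eq_prod_X_sub_C (rootPoly_monic w) (natDegree_rootPoly w)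
  exact ⟨z, rootPoly_injective n (by rw [rootPoly_symmetrization, hz])⟩

theorem mem_symmetrization_image_iff {n : ℕ} (D : Set ℂ) (w : Fin n → ℂ) :
    w ∈ symmetrization n '' {z | ∀ i, z i ∈ D} ↔ ∀ x, binaryForm w x (-1) = 0 → x ∈ D := by
  have key : ∀ z : Fin n → ℂ, ∀ x,
      binaryForm (symmetrization n z) x (-1) = 0 ↔ ∃ j, z j = x := by
    intro z x
    rw [binaryForm_symmetrization, Finset.prod_eq_zero_iff]
    refine ⟨fun ⟨j, _, hj⟩ => ⟨j, ?_⟩, fun ⟨j, hj⟩ => ⟨j, Finset.mem_univ _, ?_⟩⟩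
    · linear_combination -hj
    · rw [hj]; ring
  obtain ⟨z, rfl⟩ := symmetrization_surjective n w
  constructor
  · rintro ⟨z', hz', h⟩ x hx
    rw [← h, key] at hx
    obtain ⟨j, rfl⟩ := hx
    exact hz' j
  · intro h
    exact ⟨z, fun i => h _ ((key _ _).2 ⟨i, rfl⟩), rfl⟩

theorem mem_Gamma_iff {n : ℕ} (w : Fin n → ℂ) :
    w ∈ Gamma n ↔ ∀ x, binaryForm w x (-1) = 0 → ‖x‖ ≤ 1 :=
  mem_symmetrization_image_iff {x | ‖x‖ ≤ 1} w

theorem continuous_symmetrization (n : ℕ) : Continuous (symmetrization n) := by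
  unfold symmetrization
  fun_prop

theorem differentiable_symmetrization (n : ℕ) : Differentiable ℂ (symmetrization n) := by
  unfold symmetrization
  fun_prop

theorem isCompact_polydisc (n : ℕ) : IsCompact {z : Fin n → ℂ | ∀ i, ‖z i‖ ≤ 1} := by
  have : {z : Fin n → ℂ | ∀ i, ‖z i‖ ≤ 1} = Set.pi Set.univ fun _ => Metric.closedBall 0 1 := by
    ext z; simp
  rw [this]
  exact isCompact_univ_pi fun _ => isCompact_closedBall _ _

theorem isCompact_Gamma (n : ℕ) : IsCompact (Gamma n) :=
  (isCompact_polydisc n).image (continuous_symmetrization n)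

/-! ### The theorems of Gauss–Lucas and Cohn in terms of symmetrized coordinates -/

/-- The coordinates `γᵢ wᵢ`, `γᵢ = (n + 1 - i) / (n + 1)` for one-based `i ≤ n`, of the
derivative of the polynomial attached to `w`. -/
def derivCoords {n : ℕ} (w : Fin (n + 1) → ℂ) : Fin n → ℂ :=
  fun i => ((n : ℂ) - (i : ℕ)) / ((n : ℂ) + 1) * w i.castSucc

theorem derivative_rootPoly {n : ℕ} (w : Fin (n + 1) → ℂ) :
    derivative (rootPoly w) = C ((n : ℂ) + 1) * rootPoly (derivCoords w) := by
  have hn : ((n : ℂ) + 1) ≠ 0 := by exact_mod_cast n.succ_ne_zero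
  rw [rootPoly_eq, rootPoly_eq, derivative_add, derivative_X_pow, derivative_sum, mul_add,
    Fin.sum_univ_castSucc]
  simp only [derivative_C_mul, derivative_X_pow, Fin.val_last, Nat.sub_self, pow_zero,
    derivative_one, mul_zero, add_zero, Fin.val_castSucc]
  congr 1
  · simp
  · rw [Finset.mul_sum]
    refine Finset.sum_congr rfl fun i _ => ?_
    have hi := i.2
    rw [show n + 1 - ((i : ℕ) + 1) = n - i by omega, Nat.cast_sub hi.le,
      show n - (i : ℕ) - 1 = n - (i + 1) by omega, 
      ← mul_assoc, ← mul_assoc, ← C_mul, ← C_mul, derivCoords]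
    congr 2
    field_simp

/-- By the Gauss–Lucas theorem the derivative of a polynomial with roots in the closed disc has
its roots there, too. -/
theorem derivCoords_mem_Gamma {n : ℕ} {w : Fin (n + 1) → ℂ} (hw : w ∈ Gamma (n + 1)) :
    derivCoords w ∈ Gamma n := by
  rw [mem_Gamma_iff] at hw ⊢
  intro x hx
  have hsub : (rootPoly w).rootSet ℂ ⊆ Metric.closedBall 0 1 := by
    intro y hy
    rw [mem_rootSet] at hy
    have := hw y (by rw [← eval_rootPoly]; simpa using hy.2)
    simpa using this
  have hconv := convexHull_min hsub (convex_closedBall (0 : ℂ) 1)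
  have hne : C ((n : ℂ) + 1) ≠ 0 := by
    rw [Ne, C_eq_zero]; exact_mod_cast n.succ_ne_zero
  have hdeg : 0 < (rootPoly w).degree :=
    natDegree_pos_iff_degree_pos.1 (by rw [natDegree_rootPoly]; exact n.succ_pos)
  have hx' : x ∈ (derivative (rootPoly w)).rootSet ℂ := by
    rw [mem_rootSet, derivative_rootPoly]
    refine ⟨mul_ne_zero hne (rootPoly_monic _).ne_zero, ?_⟩
    simp [eval_rootPoly, hx]
  have := hconv (rootSet_derivative_subset_convexHull_rootSet hdeg hx')
  simpa using this

/-- The polynomial `N P(x) - x P'(x)` for `P` attached to a self-inversive `w` is, up to a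
unimodular factor, the reversed derivative. -/
theorem self_inversive_identity {n : ℕ} {w : Fin (n + 1) → ℂ}
    (hinv : ∀ i : Fin n, w i.castSucc = (starRingEnd ℂ) (w i.rev.castSucc) * w (Fin.last n))
    (x : ℂ) :
    ((n : ℂ) + 1) * binaryForm w x (-1) - x * (((n : ℂ) + 1) * binaryForm (derivCoords w) x (-1)) =
      (-1) ^ (n + 1) * w (Fin.last n) * ((n : ℂ) + 1) *
        binaryForm (fun i => (starRingEnd ℂ) (derivCoords w i)) 1 (-x) := by
  have hn : ((n : ℂ) + 1) ≠ 0 := by exact_mod_cast n.succ_ne_zero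
  have h1 : binaryForm (fun i => (starRingEnd ℂ) (derivCoords w i)) 1 (-x) =
      1 + ∑ i : Fin n, (-x) ^ (n - (i : ℕ)) * (starRingEnd ℂ) (derivCoords w i.rev) := by
    rw [binaryForm, one_pow, ← Equiv.sum_comp Fin.revPerm]
    congr 1
    refine Finset.sum_congr rfl fun i _ => ?_
    have hi := i.2
    rw [one_pow, one_mul, Fin.revPerm_apply, Fin.val_rev,
      show n - ((i : ℕ) + 1) + 1 = n - i by omega]
  rw [h1, binaryForm, binaryForm, Fin.sum_univ_castSucc]
  simp only [Fin.val_castSucc, Fin.val_last, Nat.sub_self, pow_zero, one_mul]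
  have h2 : ∀ i : Fin n, ((n : ℂ) + 1) * (x ^ (n + 1 - ((i : ℕ) + 1)) * (-1) ^ ((i : ℕ) + 1)
      * w i.castSucc) - x * (((n : ℂ) + 1) *
        (x ^ (n - ((i : ℕ) + 1)) * (-1) ^ ((i : ℕ) + 1) * derivCoords w i)) =
      (-1) ^ (n + 1) * w (Fin.last n) * ((n : ℂ) + 1) *
        ((-x) ^ (n - (i : ℕ)) * (starRingEnd ℂ) (derivCoords w i.rev)) := by
    intro i
    have hi := i.2
    obtain ⟨k, hk⟩ : ∃ k, n = i + 1 + k := ⟨n - (i + 1), by omega⟩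
    have hkc : (n : ℂ) = (i : ℕ) + 1 + k := by exact_mod_cast congrArg (Nat.cast (R := ℂ)) hk
    have e1 : n + 1 - ((i : ℕ) + 1) = k + 1 := by omega
    have e2 : n - ((i : ℕ) + 1) = k := by omega
    have e3 : n - (i : ℕ) = k + 1 := by omega
    have e4 : ((i.rev : Fin n) : ℕ) = k := by rw [Fin.val_rev]; omega
    have e5 : ((-1 : ℂ)) ^ (n + 1) = (-1) ^ ((i : ℕ) + 1) * (-1) ^ (k + 1) := by
      rw [← pow_add]; congr 1; omega
    have e6 : ((-1 : ℂ)) ^ (k + 1) * (-x) ^ (k + 1) = x ^ (k + 1) := by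
      rw [← mul_pow]; ring
    rw [e1, e2, e3, e5, derivCoords, derivCoords, e4]
    rw [hinv i]
    simp only [map_mul, map_div₀, map_sub, map_add, map_natCast, map_one]
    rw [show (-1 : ℂ) ^ ((i : ℕ) + 1) * (-1) ^ (k + 1) * w (Fin.last n) * ((n : ℂ) + 1) *
        ((-x) ^ (k + 1) * (((n : ℂ) - k) / ((n : ℂ) + 1) * (starRingEnd ℂ) (w i.rev.castSucc))) =
        (-1 : ℂ) ^ ((i : ℕ) + 1) * ((-1 : ℂ) ^ (k + 1) * (-x) ^ (k + 1)) * w (Fin.last n) *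
        ((n : ℂ) + 1) * ((((n : ℂ) - k) / ((n : ℂ) + 1) *
          (starRingEnd ℂ) (w i.rev.castSucc))) by ring, e6]
    field_simp
    rw [hkc]
    ring
  have h3 := Finset.sum_congr (s₁ := Finset.univ) rfl fun i _ => h2 i
  rw [Finset.sum_sub_distrib, ← Finset.mul_sum, ← Finset.mul_sum, ← Finset.mul_sum,
    ← Finset.mul_sum] at h3
  linear_combination h3

theorem norm_one_sub_mul_conj_le {a x : ℂ} (ha : ‖a‖ ≤ 1) (hx : 1 ≤ ‖x‖) :
    ‖1 - x * (starRingEnd ℂ) a‖ ≤ ‖x - a‖ := by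
  have key : ‖x - a‖ ^ 2 - ‖1 - x * (starRingEnd ℂ) a‖ ^ 2 = (‖x‖ ^ 2 - 1) * (1 - ‖a‖ ^ 2) := by
    simp only [← Complex.normSq_eq_norm_sq, Complex.normSq_apply, Complex.sub_re, Complex.sub_im,
      Complex.mul_re, Complex.mul_im, Complex.conj_re, Complex.conj_im, Complex.one_re,
      Complex.one_im]
    ring
  have h1 : 0 ≤ (‖x‖ ^ 2 - 1) * (1 - ‖a‖ ^ 2) :=
    mul_nonneg (by nlinarith) (by nlinarith [norm_nonneg a])
  exact le_of_sq_le_sq (by linarith) (norm_nonneg _)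

/-- **Cohn's theorem**: a self-inversive polynomial whose derivative has all its roots in the
closed disc has all its roots on the unit circle. At a root `x` with `|x| > 1` of the polynomial `P`
the identity for `N P(x) - x P'(x)` would give `|x| |P'(x)| ≤ |P'(x)|`. -/
theorem mem_symmetrization_torus {n : ℕ} {w : Fin (n + 1) → ℂ} (hlast : ‖w (Fin.last n)‖ = 1)
    (hinv : ∀ i : Fin n, w i.castSucc = (starRingEnd ℂ) (w i.rev.castSucc) * w (Fin.last n))
    (hderiv : derivCoords w ∈ Gamma n) :
    w ∈ symmetrization (n + 1) '' {z | ∀ i, ‖z i‖ = 1} := by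
  obtain ⟨z', hz', hzw⟩ := hderiv
  have hdisc : ∀ x, binaryForm w x (-1) = 0 → ‖x‖ ≤ 1 := by
    intro x hx
    by_contra! hlt
    have hid := self_inversive_identity hinv x
    have hconj : binaryForm (fun i => (starRingEnd ℂ) (derivCoords w i)) 1 (-x) =
        ∏ j, (1 - x * (starRingEnd ℂ) (z' j)) := by
      have := binaryForm_symmetrization (fun j => (starRingEnd ℂ) (z' j)) 1 (-x)
      rw [show (symmetrization n fun j => (starRingEnd ℂ) (z' j)) =
        fun i => (starRingEnd ℂ) (derivCoords w i) by
          rw [← hzw]; ext i; simp [symmetrization]] at this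
      rw [this]
      exact Finset.prod_congr rfl fun j _ => by ring
    have hd : binaryForm (derivCoords w) x (-1) = ∏ j, (x - z' j) := by
      rw [← hzw, binaryForm_symmetrization]
      exact Finset.prod_congr rfl fun j _ => by ring
    rw [hx, hconj, hd, mul_zero, zero_sub] at hid
    have hid := congrArg norm hid
    rw [norm_neg, norm_mul, norm_mul, norm_mul, norm_mul, norm_mul, norm_pow, norm_neg, norm_one,
      one_pow, hlast, one_mul, one_mul, norm_prod, norm_prod] at hid
    have hle : ∏ j, ‖1 - x * (starRingEnd ℂ) (z' j)‖ ≤ ∏ j, ‖x - z' j‖ :=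
      Finset.prod_le_prod (fun _ _ => norm_nonneg _) fun j _ =>
        norm_one_sub_mul_conj_le (hz' j) hlt.le
    have hpos : 0 < ∏ j, ‖x - z' j‖ := by
      refine Finset.prod_pos fun j _ => norm_pos_iff.2 fun h0 => ?_
      have h2 := hz' j
      rw [← sub_eq_zero.1 h0] at h2
      linarith
    have hnn : 0 < ‖(n : ℂ) + 1‖ := norm_pos_iff.2 (by exact_mod_cast n.succ_ne_zero)
    have h3 := mul_pos hnn hpos
    nlinarith [mul_le_mul_of_nonneg_left hle hnn.le]
  obtain ⟨z, hz, rfl⟩ := (mem_Gamma_iff w).2 hdisc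
  refine ⟨z, fun i => ?_, rfl⟩
  -- The product of the roots is unimodular, so no root can lie in the open disc.
  have hprod : ∏ j, ‖z j‖ = 1 := by
    rw [← hlast, ← norm_prod, symmetrization_last]
  refine le_antisymm (hz i) ?_
  rw [← hprod, ← Finset.mul_prod_erase _ _ (Finset.mem_univ i)]
  exact mul_le_of_le_one_right (norm_nonneg _)
    (Finset.prod_le_one (fun _ _ => norm_nonneg _) fun j _ => hz j)

end

section

open Filter Topology

/-! ### Polynomial convexity of `Γ_n` -/

theorem exists_eval_symmetrization_eq_prod (n m : ℕ) (c : ℂ) :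
    ∃ q : MvPolynomial (Fin n) ℂ,
      ∀ z, MvPolynomial.eval (symmetrization n z) q = ∏ j, (c + z j ^ m) := by
  have hsymm : (∏ j : Fin n, (MvPolynomial.C c + MvPolynomial.X j ^ m) :
      MvPolynomial (Fin n) ℂ).IsSymmetric := by
    intro e
    simp only [map_prod, map_add, map_pow, MvPolynomial.rename_C, MvPolynomial.rename_X]
    exact Equiv.prod_comp e fun j => (MvPolynomial.C c + MvPolynomial.X j ^ m)
  obtain ⟨q, hq⟩ := MvPolynomial.esymmAlgHom_surjective (σ := Fin n) (R := ℂ) (n := n)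
    (by simp) ⟨_, hsymm⟩
  refine ⟨q, fun z => ?_⟩
  have h1 : (MvPolynomial.aeval z : MvPolynomial (Fin n) ℂ →ₐ[ℂ] ℂ)
      (MvPolynomial.esymmAlgHom (Fin n) ℂ n q : MvPolynomial (Fin n) ℂ) = ∏ j, (c + z j ^ m) := by
    rw [hq]
    simp
  rw [← h1]
  have h2 : ((MvPolynomial.aeval z).comp ((MvPolynomial.symmetricSubalgebra (Fin n) ℂ).val.comp
      (MvPolynomial.esymmAlgHom (Fin n) ℂ n)) : MvPolynomial (Fin n) ℂ →ₐ[ℂ] ℂ) =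
      MvPolynomial.aeval (symmetrization n z) := by
    ext i
    simp [MvPolynomial.esymmAlgHom, symmetrization, MvPolynomial.esymm]
  rw [← MvPolynomial.coe_aeval_eq_eval, ← h2]
  rfl

theorem bddAbove_norm_eval_Gamma {n : ℕ} (p : MvPolynomial (Fin n) ℂ) :
    BddAbove ((fun z => ‖MvPolynomial.eval z p‖) '' Gamma n) :=
  (isCompact_Gamma n).bddAbove_image (MvPolynomial.continuous_eval p).norm.continuousOn

theorem Gamma_nonempty (n : ℕ) : (Gamma n).Nonempty :=
  ⟨_, 0, by simp, rfl⟩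

theorem norm_eval_le_sSup_Gamma {n : ℕ} (p : MvPolynomial (Fin n) ℂ) {w : Fin n → ℂ}
    (hw : w ∈ Gamma n) :
    ‖MvPolynomial.eval w p‖ ≤ sSup ((fun z => ‖MvPolynomial.eval z p‖) '' Gamma n) :=
  le_csSup (bddAbove_norm_eval_Gamma p) ⟨w, hw, rfl⟩

theorem sSup_norm_eval_Gamma_nonneg {n : ℕ} (p : MvPolynomial (Fin n) ℂ) :
    0 ≤ sSup ((fun z => ‖MvPolynomial.eval z p‖) '' Gamma n) := by
  obtain ⟨w, hw⟩ := Gamma_nonempty n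
  exact (norm_nonneg _).trans (norm_eval_le_sSup_Gamma p hw)

/-- `Γ_n` is polynomially convex. If `|zᵢ| > 1` for some `i`, then the symmetric polynomials
`∏ⱼ (2 + zⱼᵐ)`, which are bounded by `3ⁿ` on the polydisc, are unbounded in `m` at `z`: the factors
with `|zⱼ| ≤ 1` have modulus at least `1`. -/
theorem mem_Gamma_of_forall_norm_eval_le {n : ℕ} {w : Fin n → ℂ}
    (h : ∀ p : MvPolynomial (Fin n) ℂ,
      ‖MvPolynomial.eval w p‖ ≤ sSup ((fun z => ‖MvPolynomial.eval z p‖) '' Gamma n)) :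
    w ∈ Gamma n := by
  obtain ⟨z, rfl⟩ := symmetrization_surjective n w
  refine ⟨z, ?_, rfl⟩
  by_contra! hz
  simp only [Set.mem_ofPred_eq, not_forall, not_le] at hz
  obtain ⟨i, hi⟩ := hz
  have hev : ∀ᶠ m : ℕ in atTop, ∀ j, ‖z j‖ ≤ 1 ∨ (3 : ℝ) ^ n + 3 ≤ ‖z j‖ ^ m := by
    refine eventually_all.2 fun j => ?_
    rcases le_or_gt ‖z j‖ 1 with hj | hj
    · exact Eventually.of_forall fun _ => Or.inl hj
    · filter_upwards [(tendsto_pow_atTop_atTop_of_one_lt hj).eventually_ge_atTop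
        ((3 : ℝ) ^ n + 3)] with m hm using Or.inr hm
  obtain ⟨m, hm⟩ := hev.exists
  obtain ⟨q, hq⟩ := exists_eval_symmetrization_eq_prod n m 2
  have hbig : ∀ j, 1 < ‖z j‖ → (3 : ℝ) ^ n + 1 ≤ ‖2 + z j ^ m‖ := by
    intro j hj
    have h1 := (hm j).resolve_left hj.not_ge
    have h2 := norm_sub_norm_le (z j ^ m) (-2)
    rw [sub_neg_eq_add, add_comm, norm_neg, norm_pow, Complex.norm_ofNat] at h2
    rw [add_comm (2 : ℂ)]
    rw [add_comm] at h2
    linarith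
  have hone : ∀ j, 1 ≤ ‖2 + z j ^ m‖ := by
    intro j
    rcases le_or_gt ‖z j‖ 1 with hj | hj
    · have h2 := norm_sub_norm_le (2 : ℂ) (-(z j ^ m))
      rw [sub_neg_eq_add, norm_neg, norm_pow, Complex.norm_ofNat] at h2
      linarith [pow_le_one₀ (n := m) (norm_nonneg (z j)) hj]
    · have h3 : (0 : ℝ) ≤ 3 ^ n := by positivity
      linarith [hbig j hj]
  have hlow : (3 : ℝ) ^ n + 1 ≤ ‖MvPolynomial.eval (symmetrization n z) q‖ := by
    rw [hq, norm_prod, ← Finset.mul_prod_erase _ _ (Finset.mem_univ i)]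
    refine (hbig i hi).trans (le_mul_of_one_le_right (norm_nonneg _) ?_)
    have := Finset.prod_le_prod (s := Finset.univ.erase i) (f := fun _ => (1 : ℝ))
      (fun _ _ => zero_le_one) fun j _ => hone j
    rwa [Finset.prod_const_one] at this
  have hup : sSup ((fun z => ‖MvPolynomial.eval z q‖) '' Gamma n) ≤ (3 : ℝ) ^ n := by
    refine csSup_le ((Gamma_nonempty n).image _) ?_
    rintro _ ⟨_, ⟨y, hy, rfl⟩, rfl⟩
    change ‖MvPolynomial.eval (symmetrization n y) q‖ ≤ _
    rw [hq, norm_prod]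
    refine (Finset.prod_le_prod (g := fun _ => (3 : ℝ)) (fun _ _ => norm_nonneg _)
      fun j _ => ?_).trans (by simp)
    refine (norm_add_le _ _).trans ?_
    rw [norm_pow, Complex.norm_ofNat]
    linarith [pow_le_one₀ (n := m) (norm_nonneg (y j)) (hy j)]
  linarith [h q]

/-! ### The distinguished boundary is the symmetrized torus -/

/-- The symmetrized open polydisc consists of the `w` with `1 - w₁ x + w₂ x² - … ≠ 0` on the
compact disc `|x| ≤ 1`, and this is an open condition on `w`. -/
theorem symmetrization_openPolydisc_subset_interior (n : ℕ) :
    symmetrization n '' {z | ∀ i, ‖z i‖ < 1} ⊆ interior (Gamma n) := by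
  rintro _ ⟨z, hz, rfl⟩
  have hcont : Continuous fun p : (Fin n → ℂ) × ℂ => binaryForm p.1 1 (-p.2) := by
    unfold binaryForm
    fun_prop
  have hopen : IsOpen {p : (Fin n → ℂ) × ℂ | binaryForm p.1 1 (-p.2) ≠ 0} :=
    isOpen_ne_fun hcont continuous_const
  obtain ⟨u, v, hu, -, hzu, hv, huv⟩ := generalized_tube_lemma
    (isCompact_singleton (x := symmetrization n z)) (isCompact_closedBall (0 : ℂ) 1) hopen (by
      rintro ⟨w, x⟩ ⟨hw, hx⟩
      obtain rfl : w = symmetrization n z := hw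
      have hx : ‖x‖ ≤ 1 := by simpa using hx
      change binaryForm _ 1 (-x) ≠ 0
      rw [binaryForm_symmetrization]
      refine Finset.prod_ne_zero_iff.2 fun j _ h0 => ?_
      have h1 : x * z j = 1 := by linear_combination -h0
      have h2 := congrArg norm h1
      rw [norm_mul, norm_one] at h2
      nlinarith [hz j, norm_nonneg x, norm_nonneg (z j)])
  refine mem_interior.2 ⟨u, fun w hw => ?_, hu, hzu rfl⟩
  obtain ⟨y, rfl⟩ := symmetrization_surjective n w
  refine ⟨y, fun i => ?_, rfl⟩
  by_contra! hi
  have hyi : y i ≠ 0 := norm_pos_iff.1 (one_pos.trans hi)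
  have hmem : (y i)⁻¹ ∈ v := hv (by simpa using inv_le_one_of_one_le₀ hi.le)
  refine huv (Set.mk_mem_prod hw hmem) ?_
  change binaryForm _ 1 (-(y i)⁻¹) = 0
  rw [binaryForm_symmetrization]
  exact Finset.prod_eq_zero (Finset.mem_univ i) (by field_simp; ring)

theorem exists_norm_coord_eq_one_le {n : ℕ} {g : (Fin n → ℂ) → ℂ}
    (hg : ∀ z : Fin n → ℂ, (∀ i, ‖z i‖ ≤ 1) → DifferentiableAt ℂ g z) (s : Finset (Fin n))
    {z : Fin n → ℂ} (hz : ∀ i, ‖z i‖ ≤ 1) :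
    ∃ y : Fin n → ℂ, (∀ i, ‖y i‖ ≤ 1) ∧ (∀ i ∈ s, ‖y i‖ = 1) ∧ ‖g z‖ ≤ ‖g y‖ := by
  classical
  induction s using Finset.induction_on with
  | empty => exact ⟨z, hz, by simp, le_rfl⟩
  | insert i s his ih =>
    obtain ⟨y, hy, hys, hle⟩ := ih
    have hup : ∀ x : ℂ, ‖x‖ ≤ 1 → ∀ j, ‖Function.update y i x j‖ ≤ 1 := by
      intro x hx j
      rcases eq_or_ne j i with rfl | hj
      · simpa using hx
      · simpa [hj] using hy j
    have hd : DiffContOnCl ℂ (fun x => g (Function.update y i x)) (Metric.ball 0 1) := by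
      refine DifferentiableOn.diffContOnCl fun x hx => ?_
      rw [closure_ball _ one_ne_zero, mem_closedBall_zero_iff] at hx
      refine DifferentiableAt.differentiableWithinAt ?_
      have := hg _ (hup x hx)
      exact DifferentiableAt.comp x this (hasFDerivAt_update y x).differentiableAt
    obtain ⟨x, hx, hmax⟩ := Complex.exists_mem_frontier_isMaxOn_norm Metric.isBounded_ball
      (Metric.nonempty_ball.2 one_pos) hd
    rw [frontier_ball _ one_ne_zero, mem_sphere_zero_iff_norm] at hx
    refine ⟨Function.update y i x, hup x hx.le, fun j hj => ?_, hle.trans ?_⟩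
    · rcases eq_or_ne j i with rfl | hji
      · simpa using hx
      · simpa [hji] using hys j ((Finset.mem_insert.1 hj).resolve_left hji)
    · have := hmax (show y i ∈ closure (Metric.ball (0 : ℂ) 1) by
        rw [closure_ball _ one_ne_zero]; simpa using hy i)
      simpa using this

theorem isCompact_torus (n : ℕ) : IsCompact {z : Fin n → ℂ | ∀ i, ‖z i‖ = 1} := by
  have : {z : Fin n → ℂ | ∀ i, ‖z i‖ = 1} = Set.pi Set.univ fun _ => Metric.sphere 0 1 := by
    ext z; simp
  rw [this]
  exact isCompact_univ_pi fun _ => isCompact_sphere _ _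

/-- The maximum modulus principle on the polydisc, for functions that are continuous on the closed
polydisc and holomorphic in the open one. -/
theorem exists_mem_torus_norm_le {n : ℕ} {g : (Fin n → ℂ) → ℂ}
    (hc : ContinuousOn g {z | ∀ i, ‖z i‖ ≤ 1})
    (hd : ∀ z : Fin n → ℂ, (∀ i, ‖z i‖ < 1) → DifferentiableAt ℂ g z)
    {z : Fin n → ℂ} (hz : ∀ i, ‖z i‖ ≤ 1) :
    ∃ y : Fin n → ℂ, (∀ i, ‖y i‖ = 1) ∧ ‖g z‖ ≤ ‖g y‖ := by
  -- The principle holds for the dilated functions `x ↦ g (r x)`, `r < 1`; then `r` tends to `1`.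
  let r : ℕ → ℝ := fun k => 1 - 1 / ((k : ℝ) + 1)
  have hr0 : ∀ k, 0 ≤ r k := fun k => by
    have : 1 / ((k : ℝ) + 1) ≤ 1 := by
      rw [div_le_one (by positivity)]; linarith [(Nat.cast_nonneg k : (0 : ℝ) ≤ k)]
    simp only [r]; linarith
  have hr1 : ∀ k, r k < 1 := fun k => by
    have : 0 < 1 / ((k : ℝ) + 1) := by positivity
    simp only [r]; linarith
  have hrlim : Tendsto (fun k => (r k : ℂ)) atTop (𝓝 1) := by
    have : Tendsto r atTop (𝓝 (1 - 0)) :=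
      tendsto_const_nhds.sub tendsto_one_div_add_atTop_nhds_zero_nat
    rw [sub_zero] at this
    exact_mod_cast (Complex.continuous_ofReal.tendsto 1).comp this
  have hnorm : ∀ k (x : Fin n → ℂ), ∀ i, ‖((r k : ℂ) • x) i‖ = r k * ‖x i‖ := by
    intro k x i
    rw [Pi.smul_apply, smul_eq_mul, norm_mul, Complex.norm_real, Real.norm_of_nonneg (hr0 k)]
  have key : ∀ k, ∃ y : Fin n → ℂ, (∀ i, ‖y i‖ = 1) ∧
      ‖g ((r k : ℂ) • z)‖ ≤ ‖g ((r k : ℂ) • y)‖ := by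
    intro k
    obtain ⟨y, -, hy, hle⟩ := exists_norm_coord_eq_one_le (g := fun x => g ((r k : ℂ) • x))
      (fun x hx => by
        have h1 : DifferentiableAt ℂ g ((r k : ℂ) • x) := hd _ fun i => by
          rw [hnorm]
          exact (mul_le_of_le_one_right (hr0 k) (hx i)).trans_lt (hr1 k)
        exact DifferentiableAt.comp x h1 (by fun_prop)) Finset.univ hz
    exact ⟨y, fun i => hy i (Finset.mem_univ i), hle⟩
  choose y hy hle using key
  obtain ⟨a, ha, φ, hφ, hlim⟩ := (isCompact_torus n).tendsto_subseq hy
  refine ⟨a, ha, ?_⟩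
  have hcl : ∀ (b : ℕ → Fin n → ℂ) (c : Fin n → ℂ), (∀ k i, ‖b k i‖ ≤ 1) → (∀ i, ‖c i‖ ≤ 1) →
      Tendsto b atTop (𝓝 c) →
      Tendsto (fun k => ‖g ((r (φ k) : ℂ) • b k)‖) atTop (𝓝 ‖g c‖) := by
    intro b c hb hc' hbc
    have h1 : Tendsto (fun k => (r (φ k) : ℂ) • b k) atTop (𝓝 ((1 : ℂ) • c)) :=
      (hrlim.comp hφ.tendsto_atTop).smul hbc
    rw [one_smul] at h1
    have h2 : Tendsto (fun k => (r (φ k) : ℂ) • b k) atTop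
        (𝓝[{z | ∀ i, ‖z i‖ ≤ 1}] c) :=
      tendsto_nhdsWithin_iff.2 ⟨h1, Eventually.of_forall fun k i => by
        rw [hnorm]
        exact (mul_le_of_le_one_right (hr0 _) (hb k i)).trans (hr1 _).le⟩
    exact ((hc c hc').tendsto.comp h2).norm
  exact le_of_tendsto_of_tendsto' (hcl (fun _ => z) z (fun _ => hz) hz tendsto_const_nhds)
    (hcl _ a (fun k i => (hy _ i).le) (fun i => (ha i).le) hlim) fun k => hle (φ k)

theorem isClosedBoundary_symmetrization_torus (n : ℕ) :
    IsClosedBoundary (Gamma n) (symmetrization n '' {z | ∀ i, ‖z i‖ = 1}) := by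
  refine ⟨Set.image_mono fun z hz i => (hz i).le,
    ((isCompact_torus n).image (continuous_symmetrization n)).isClosed, ?_⟩
  rintro f ⟨hc, hd⟩ _ ⟨z, hz, rfl⟩
  obtain ⟨y, hy, hle⟩ := exists_mem_torus_norm_le (g := f ∘ symmetrization n)
    (hc.comp (continuous_symmetrization n).continuousOn fun z hz => ⟨z, hz, rfl⟩)
    (fun z hz => by
      have hmem := symmetrization_openPolydisc_subset_interior n ⟨z, hz, rfl⟩
      exact (hd.differentiableAt (isOpen_interior.mem_nhds hmem)).comp z
        (differentiable_symmetrization n z)) hz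
  exact ⟨_, ⟨y, hy, rfl⟩, hle⟩

theorem eq_one_of_norm_one_add_eq_two {x : ℂ} (hx : ‖x‖ ≤ 1) (h : ‖1 + x‖ = 2) : x = 1 := by
  have h1 : (1 + x.re) ^ 2 + x.im ^ 2 = 4 := by
    have := Complex.sq_norm (1 + x)
    rw [h, Complex.normSq_apply] at this
    simp only [Complex.add_re, Complex.add_im, Complex.one_re, Complex.one_im] at this
    nlinarith
  have h2 : x.re ^ 2 + x.im ^ 2 ≤ 1 := by
    have := Complex.sq_norm x
    rw [Complex.normSq_apply] at this
    nlinarith [norm_nonneg x]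
  have h3 : x.re = 1 := by nlinarith
  have h4 : x.im = 0 := by
    rw [h3] at h2
    nlinarith [sq_nonneg x.im]
  exact Complex.ext h3 h4

/-- A symmetrized point whose coordinates are `m`-th roots of unity belongs to every closed
boundary. The function `∏ⱼ (1 + zⱼᵐ) / 2` has maximal modulus precisely at the finitely many
points of this kind, and its high powers times a polynomial that separates the given point from the
other ones violate the boundary property of a closed set not containing the point. -/
theorem symmetrization_rootsOfUnity_mem {n m : ℕ} (hm : 0 < m) {B : Set (Fin n → ℂ)}
    (hB : IsClosedBoundary (Gamma n) B) {ζ : Fin n → ℂ} (hζ : ∀ i, ζ i ^ m = 1) :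
    symmetrization n ζ ∈ B := by
  classical
  obtain ⟨hBΓ, hBc, hBmax⟩ := hB
  set p := symmetrization n ζ with hp
  obtain ⟨q, hq⟩ := exists_eval_symmetrization_eq_prod n m 1
  let F : (Fin n → ℂ) → ℂ := fun w => MvPolynomial.eval w q * (2 ^ n)⁻¹
  have hqdiff : Differentiable ℂ fun w : Fin n → ℂ => MvPolynomial.eval w q :=
    fun w => (AnalyticOnNhd.eval_mvPolynomial q w (Set.mem_univ w)).differentiableAt
  have hFdiff : Differentiable ℂ F := hqdiff.mul_const ((2 : ℂ) ^ n)⁻¹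
  have hFs : ∀ z, ‖F (symmetrization n z)‖ = ∏ j, (‖1 + z j ^ m‖ / 2) := by
    intro z
    simp only [F]
    rw [hq, ← div_eq_mul_inv, norm_div, norm_prod, Finset.prod_div_distrib, norm_pow,
      Complex.norm_ofNat]
    simp
  have hfac : ∀ z : Fin n → ℂ, (∀ i, ‖z i‖ ≤ 1) → ∀ j, ‖1 + z j ^ m‖ / 2 ≤ 1 := by
    intro z hz j
    rw [div_le_one two_pos]
    refine (norm_add_le _ _).trans ?_
    rw [norm_one, norm_pow]
    linarith [pow_le_one₀ (n := m) (norm_nonneg (z j)) (hz j)]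
  have hF1 : ∀ w ∈ Gamma n, ‖F w‖ ≤ 1 := by
    rintro _ ⟨z, hz, rfl⟩
    rw [hFs]
    exact Finset.prod_le_one (fun _ _ => by positivity) fun j _ => hfac z hz j
  -- The finite set of the points at which `‖F‖ = 1`.
  let P : Set (Fin n → ℂ) := symmetrization n '' {z | ∀ i, z i ^ m = 1}
  have hPfin : P.Finite := by
    have hfin : {x : ℂ | x ^ m = 1}.Finite := by
      refine (Polynomial.nthRootsFinset m (1 : ℂ)).finite_toSet.subset fun x hx => ?_
      simpa [Polynomial.mem_nthRootsFinset hm] using hx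
    have := Set.Finite.pi' (ι := Fin n) (fun _ => hfin)
    exact this.image _
  have hFP : ∀ w ∈ Gamma n, ‖F w‖ = 1 → w ∈ P := by
    rintro _ ⟨z, hz, rfl⟩ h1
    refine ⟨z, fun i => ?_, rfl⟩
    refine eq_one_of_norm_one_add_eq_two
      (by rw [norm_pow]; exact pow_le_one₀ (norm_nonneg _) (hz i)) ?_
    rw [hFs, ← Finset.mul_prod_erase _ _ (Finset.mem_univ i)] at h1
    have h2 : ∏ j ∈ Finset.univ.erase i, (‖1 + z j ^ m‖ / 2) ≤ 1 :=
      Finset.prod_le_one (fun _ _ => by positivity) fun j _ => hfac z hz j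
    have h3 := hfac z hz i
    have h4 : 0 ≤ ‖1 + z i ^ m‖ / 2 := by positivity
    have h5 : ‖1 + z i ^ m‖ / 2 = 1 := le_antisymm h3 (by nlinarith)
    linarith
  have hζ1 : ∀ i, ‖ζ i‖ = 1 := fun i => by
    have := congrArg norm (hζ i)
    rw [norm_pow, norm_one] at this
    exact (pow_eq_one_iff_of_nonneg (norm_nonneg _) hm.ne').1 this
  have hpΓ : p ∈ Gamma n := ⟨ζ, fun i => (hζ1 i).le, rfl⟩
  have hFp : ‖F p‖ = 1 := by
    rw [hp, hFs]
    refine Finset.prod_eq_one fun j _ => ?_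
    rw [hζ j]
    norm_num
  -- A polynomial that vanishes on `P` except at `p`.
  have hsep : ∃ g : (Fin n → ℂ) → ℂ, Differentiable ℂ g ∧ g p = 1 ∧ ∀ x ∈ P, x ≠ p → g x = 0 := by
    have hc : ∀ y : Fin n → ℂ, ∃ h : (Fin n → ℂ) → ℂ, Differentiable ℂ h ∧ h p = 1 ∧
        (y ≠ p → h y = 0) := fun y => by
      by_cases hy : y = p
      · exact ⟨fun _ => 1, differentiable_const _, rfl, fun h => absurd hy h⟩
      · obtain ⟨i, hi⟩ := Function.ne_iff.1 hy
        refine ⟨fun x => (x i - y i) / (p i - y i), by fun_prop,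
          div_self (sub_ne_zero.2 (Ne.symm hi)), fun _ => by simp⟩
    choose h hd h1 h0 using hc
    have hprod : ∀ s : Finset (Fin n → ℂ), Differentiable ℂ fun x => ∏ y ∈ s, h y x := fun s => by
      induction s using Finset.induction_on with
      | empty => simp
      | insert y s hy ih =>
        simp only [Finset.prod_insert hy]
        exact (hd y).fun_mul ih
    refine ⟨fun x => ∏ y ∈ hPfin.toFinset, h y x, hprod _,
      Finset.prod_eq_one fun y _ => h1 y, fun x hx hxp => ?_⟩
    exact Finset.prod_eq_zero (hPfin.mem_toFinset.2 hx) (h0 x hxp)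
  obtain ⟨g, hgd, hgp, hgP⟩ := hsep
  by_contra hpB
  have hBcpt : IsCompact B := (isCompact_Gamma n).of_isClosed_subset hBc hBΓ
  have hcl : ∀ k : ℕ, IsClosed (B ∩ {w | 1 ≤ ‖g w‖ * ‖F w‖ ^ k}) := fun k =>
    hBc.inter (isClosed_le continuous_const
      (hgd.continuous.norm.mul (hFdiff.continuous.norm.pow k)))
  obtain ⟨w, hw⟩ := IsCompact.nonempty_iInter_of_sequence_nonempty_isCompact_isClosed
    (fun k : ℕ => B ∩ {w | 1 ≤ ‖g w‖ * ‖F w‖ ^ k})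
    (fun k w hw => ⟨hw.1, hw.2.trans (mul_le_mul_of_nonneg_left
      (pow_le_pow_of_le_one (norm_nonneg _) (hF1 w (hBΓ hw.1)) k.le_succ) (norm_nonneg _))⟩)
    (fun k => by
      have hfd : Differentiable ℂ fun w => g w * F w ^ k := hgd.mul (hFdiff.pow k)
      obtain ⟨y, hy, hle⟩ := hBmax (fun w => g w * F w ^ k)
        ⟨hfd.continuous.continuousOn, hfd.differentiableOn⟩ p hpΓ
      simp only [norm_mul, norm_pow, hgp, norm_one, hFp, one_pow, mul_one] at hle
      exact ⟨y, hy, hle⟩)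
    (hBcpt.of_isClosed_subset (hcl 0) Set.inter_subset_left) hcl
  rw [Set.mem_iInter] at hw
  have hwB : w ∈ B := (hw 0).1
  have hFw : ‖F w‖ = 1 := by
    refine le_antisymm (hF1 w (hBΓ hwB)) ?_
    by_contra! hlt
    have hlim := (tendsto_pow_atTop_nhds_zero_of_lt_one (norm_nonneg (F w)) hlt).const_mul ‖g w‖
    rw [mul_zero] at hlim
    have := ge_of_tendsto' hlim fun k => (hw k).2
    linarith
  have hg0 := hgP w (hFP w (hBΓ hwB) hFw) fun h => hpB (h ▸ hwB)
  have hge : 1 ≤ ‖g w‖ * ‖F w‖ ^ 0 := (hw 0).2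
  rw [hg0, norm_zero, zero_mul] at hge
  linarith

theorem exists_tendsto_rootsOfUnity {n : ℕ} {ζ : Fin n → ℂ} (hζ : ∀ i, ‖ζ i‖ = 1) :
    ∃ u : ℕ → Fin n → ℂ, (∀ m, 0 < m → ∀ i, u m i ^ m = 1) ∧ Tendsto u atTop (𝓝 ζ) := by
  have harg : ∀ i, ∃ t : ℝ, 0 ≤ t ∧ Complex.exp (2 * Real.pi * Complex.I * t) = ζ i := by
    intro i
    obtain ⟨θ, hθ⟩ := (Complex.norm_eq_one_iff (ζ i)).1 (hζ i)
    have hπ := Real.pi_pos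
    refine ⟨θ / (2 * Real.pi) + ⌈|θ / (2 * Real.pi)|⌉₊, ?_, ?_⟩
    · linarith [neg_abs_le (θ / (2 * Real.pi)), Nat.le_ceil |θ / (2 * Real.pi)|]
    · rw [← hθ]
      have hπc : (Real.pi : ℂ) ≠ 0 := by exact_mod_cast hπ.ne'
      rw [Complex.exp_eq_exp_iff_exists_int]
      refine ⟨⌈|θ / (2 * Real.pi)|⌉₊, ?_⟩
      push_cast
      field_simp
  choose t ht0 ht using harg
  refine ⟨fun m i => Complex.exp (2 * Real.pi * Complex.I * ((⌊t i * m⌋₊ : ℝ) / (m : ℝ) : ℝ)),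
    fun m hm i => ?_, ?_⟩
  · rw [← Complex.exp_nat_mul, Complex.exp_eq_one_iff]
    have hmc : (m : ℂ) ≠ 0 := by exact_mod_cast hm.ne'
    refine ⟨⌊t i * m⌋₊, ?_⟩
    push_cast
    field_simp
  · refine tendsto_pi_nhds.2 fun i => ?_
    rw [← ht i]
    have h1 : Tendsto (fun m : ℕ => ((⌊t i * m⌋₊ : ℝ) / (m : ℝ))) atTop (𝓝 (t i)) :=
      (tendsto_nat_floor_mul_div_atTop (ht0 i)).comp tendsto_natCast_atTop_atTop
    have h2 : Continuous fun x : ℝ => Complex.exp (2 * Real.pi * Complex.I * x) := by fun_prop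
    exact (h2.tendsto (t i)).comp h1

theorem distinguishedBoundary_eq (n : ℕ) :
    distinguishedBoundary n = symmetrization n '' {z | ∀ i, ‖z i‖ = 1} := by
  refine (Set.sInter_subset_of_mem (isClosedBoundary_symmetrization_torus n)).antisymm ?_
  rintro _ ⟨ζ, hζ, rfl⟩ B hB
  obtain ⟨u, hu, hlim⟩ := exists_tendsto_rootsOfUnity hζ
  refine hB.2.1.mem_of_tendsto (((continuous_symmetrization n).tendsto ζ).comp hlim) ?_
  filter_upwards [eventually_gt_atTop 0] with m hm
  exact symmetrization_rootsOfUnity_mem hm hB (hu m hm)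

end

/-! ### Polynomials in operator tuples -/

section PolyEval

variable {H K : Type*} [NormedAddCommGroup H] [InnerProductSpace ℂ H]
  [NormedAddCommGroup K] [InnerProductSpace ℂ K]

theorem map_polyEval {n : ℕ} (p : MvPolynomial (Fin n) ℂ) {S : Fin n → H →L[ℂ] H}
    {S' : Fin n → K →L[ℂ] K} (W : H →ₗ[ℂ] K) (h : ∀ i x, W (S i x) = S' i (W x)) (x : H) :
    W (polyEval p S x) = polyEval p S' (W x) := by
  have hpow : ∀ i (k : ℕ) x, W ((S i ^ k) x) = (S' i ^ k) (W x) := by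
    intro i k
    induction k with
    | zero => intro x; simp
    | succ k ih => intro x; rw [pow_succ, pow_succ, mul_apply_eq_comp, ih, h]; rfl
  have hlist : ∀ (m : Fin n →₀ ℕ) (l : List (Fin n)) x,
      W ((l.map fun i => S i ^ m i).prod x) = (l.map fun i => S' i ^ m i).prod (W x) := by
    intro m l
    induction l with
    | nil => intro x; simp
    | cons i l ih =>
      intro x
      rw [List.map_cons, List.prod_cons, mul_apply_eq_comp, hpow, ih, List.map_cons,
        List.prod_cons]
      rfl
  simp only [polyEval, _root_.sum_apply, map_sum, _root_.smul_apply,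
    map_smul, List.ofFn_eq_map, hlist]

theorem continuous_polyEval {α : Type*} [TopologicalSpace α] {n : ℕ}
    (p : MvPolynomial (Fin n) ℂ) {X : α → Fin n → H →L[ℂ] H} (hX : ∀ i, Continuous fun a => X a i) :
    Continuous fun a => polyEval p (X a) := by
  unfold polyEval
  refine continuous_finsetSum _ fun m _ => Continuous.fun_const_smul ?_ _
  simp only [List.ofFn_eq_map]
  exact continuous_list_prod _ fun i _ => (hX i).pow _

/-- If the tuples `X` and `T` agree modulo the left ideal generated by an operator that commutes
with `T`, then so do their polynomials. -/
theorem exists_polyEval_sub_eq_mul {n : ℕ} (p : MvPolynomial (Fin n) ℂ)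
    {X T : Fin n → H →L[ℂ] H} {F : H →L[ℂ] H} (hF : ∀ i, Commute F (T i))
    (h : ∀ i, ∃ R, X i - T i = R * F) : ∃ R, polyEval p X - polyEval p T = R * F := by
  have hmul : ∀ {X₁ T₁ X₂ T₂ : H →L[ℂ] H}, (∃ R, X₁ - T₁ = R * F) → (∃ R, X₂ - T₂ = R * F) →
      Commute F T₂ → ∃ R, X₁ * X₂ - T₁ * T₂ = R * F := by
    rintro X₁ T₁ X₂ T₂ ⟨R₁, h₁⟩ ⟨R₂, h₂⟩ hc
    refine ⟨X₁ * R₂ + R₁ * T₂, ?_⟩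
    rw [add_mul, mul_assoc, mul_assoc, ← hc.eq, ← mul_assoc R₁, ← h₁, ← h₂, mul_sub, sub_mul]
    abel
  have hpow : ∀ i (k : ℕ), ∃ R, X i ^ k - T i ^ k = R * F := by
    intro i k
    induction k with
    | zero => exact ⟨0, by simp⟩
    | succ k ih =>
      rw [pow_succ, pow_succ]
      exact hmul ih (h i) (hF i)
  have hlist : ∀ (m : Fin n →₀ ℕ) (l : List (Fin n)),
      ∃ R, (l.map fun i => X i ^ m i).prod - (l.map fun i => T i ^ m i).prod = R * F := by
    intro m l
    induction l with
    | nil => exact ⟨0, by simp⟩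
    | cons i l ih =>
      rw [List.map_cons, List.prod_cons, List.map_cons, List.prod_cons]
      refine hmul (hpow i _) ih (Commute.list_prod_right _ _ fun y hy => ?_)
      obtain ⟨j, -, rfl⟩ := List.mem_map.1 hy
      exact (hF j).pow_right _
  choose R hR using fun m => hlist m (List.finRange n)
  refine ⟨∑ m ∈ p.support, p.coeff m • R m, ?_⟩
  simp only [polyEval, List.ofFn_eq_map]
  rw [← Finset.sum_sub_distrib, Finset.sum_mul]
  exact Finset.sum_congr rfl fun m _ => by rw [← smul_sub, hR, smul_mul_assoc]

variable [CompleteSpace H]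

/-- A polynomial in elements of a star subalgebra belongs to the subalgebra, and characters
commute with its formation. -/
theorem exists_coe_eq_polyEval {n : ℕ} (B : StarSubalgebra ℂ (H →L[ℂ] H)) (s : Fin n → B)
    (p : MvPolynomial (Fin n) ℂ) :
    ∃ b : B, (b : H →L[ℂ] H) = polyEval p (fun i => (s i : H →L[ℂ] H)) ∧
      ∀ χ : B →ₐ[ℂ] ℂ, χ b = MvPolynomial.eval (fun i => χ (s i)) p := by
  refine ⟨∑ m ∈ p.support, p.coeff m • (List.ofFn fun i => s i ^ m i).prod, ?_, fun χ => ?_⟩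
  · change B.subtype _ = _
    simp only [polyEval, map_sum, map_smul, map_list_prod, List.ofFn_eq_map, List.map_map]
    rfl
  · rw [MvPolynomial.eval_eq']
    simp only [map_sum, map_smul, map_list_prod, List.ofFn_eq_map, List.map_map, smul_eq_mul]
    refine Finset.sum_congr rfl fun m _ => congrArg _ ?_
    rw [← List.ofFn_eq_map, List.prod_ofFn]
    simp

end PolyEval

/-! ### Characters of the `C*`-algebra of a `Γ_n`-unitary -/

theorem symmetrization_torus_self_inversive {n : ℕ} {ζ : Fin (n + 1) → ℂ} (hζ : ∀ i, ‖ζ i‖ = 1)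
    (i : Fin n) : symmetrization (n + 1) ζ i.castSucc =
      (starRingEnd ℂ) (symmetrization (n + 1) ζ i.rev.castSucc) *
        symmetrization (n + 1) ζ (Fin.last n) := by
  have hi := i.2
  rw [symmetrization_last]
  simp only [symmetrization, map_sum, map_prod, Finset.sum_mul, Fin.val_castSucc, Fin.val_rev]
  refine Finset.sum_nbij' (fun t => tᶜ) (fun t => tᶜ) ?_ ?_ (fun t _ => compl_compl t)
    (fun t _ => compl_compl t) ?_
  · intro t ht
    rw [Finset.mem_powersetCard] at ht ⊢
    exact ⟨Finset.subset_univ _, by rw [Finset.card_compl, ht.2, Fintype.card_fin]; omega⟩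
  · intro t ht
    rw [Finset.mem_powersetCard] at ht ⊢
    exact ⟨Finset.subset_univ _, by rw [Finset.card_compl, ht.2, Fintype.card_fin]; omega⟩
  · intro t _
    have h1 : (∏ j ∈ tᶜ, (starRingEnd ℂ) (ζ j)) * ∏ j ∈ tᶜ, ζ j = 1 := by
      rw [← Finset.prod_mul_distrib]
      refine Finset.prod_eq_one fun j _ => ?_
      rw [mul_comm, Complex.mul_conj, Complex.normSq_eq_norm_sq, hζ]
      simp
    rw [← Finset.prod_mul_prod_compl t ζ]
    linear_combination (-∏ j ∈ t, ζ j) * h1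

section Unitary

variable {K : Type u} [NormedAddCommGroup K] [InnerProductSpace ℂ K] [CompleteSpace K]

instance isClosed_cstar {n : ℕ} (T : Fin n → K →L[ℂ] K) : IsClosed (cstar T : Set (K →L[ℂ] K)) :=
  isClosed_closure

theorem cstar_mul_comm {n : ℕ} {T : Fin n → K →L[ℂ] K} (hT : ∀ i j, Commute (T i) (T j))
    (hN : ∀ i, IsStarNormal (T i)) (x y : cstar T) : x * y = y * x := by
  have hcomm : IsMulCommutative (StarAlgebra.adjoin ℂ (Set.range T)) := by
    refine StarAlgebra.isMulCommutative_adjoin ℂ ?_ ?_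
    · rintro _ ⟨i, rfl⟩ _ ⟨j, rfl⟩
      exact hT i j
    · rintro _ ⟨i, rfl⟩ _ ⟨j, rfl⟩
      exact (hN j).commute_star_right (hT i j)
  exact (StarSubalgebra.commRingTopologicalClosure _ fun a b => mul_comm' a b).mul_comm x y

/-- Gelfand theory: in the commutative `C*`-algebra generated by commuting normal operators the norm
is the supremum of the moduli of the values of the characters. -/
theorem norm_le_of_forall_character {n : ℕ} {T : Fin n → K →L[ℂ] K}
    (hT : ∀ i j, Commute (T i) (T j)) (hN : ∀ i, IsStarNormal (T i)) (b : cstar T) {c : ℝ}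
    (hc : 0 ≤ c) (h : ∀ χ : WeakDual.characterSpace ℂ (cstar T), ‖χ b‖ ≤ c) : ‖b‖ ≤ c := by
  let _ : CommCStarAlgebra (cstar T) :=
    { (inferInstance : CStarAlgebra (cstar T)) with mul_comm := cstar_mul_comm hT hN }
  have h1 := (AddMonoidHomClass.isometry_iff_norm _).1
    (gelfandTransform_isometry (cstar T)) b
  rw [← h1]
  exact (ContinuousMap.norm_le _ hc).2 h

theorem eq_of_forall_character {n : ℕ} {T : Fin n → K →L[ℂ] K}
    (hT : ∀ i j, Commute (T i) (T j)) (hN : ∀ i, IsStarNormal (T i)) {a b : cstar T}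
    (h : ∀ χ : WeakDual.characterSpace ℂ (cstar T), χ a = χ b) : a = b := by
  rw [← sub_eq_zero, ← norm_le_zero_iff]
  refine norm_le_of_forall_character hT hN _ le_rfl fun χ => ?_
  rw [map_sub, h, sub_self, norm_zero]

/-- The operators `γᵢ Tᵢ`, `γᵢ = (n + 1 - i) / (n + 1)` for one-based `i ≤ n`, of a tuple of length
`n + 1`. -/
def derivTuple {H : Type*} [NormedAddCommGroup H] [InnerProductSpace ℂ H] {n : ℕ}
    (T : Fin (n + 1) → H →L[ℂ] H) : Fin n → H →L[ℂ] H :=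
  fun i => (((n : ℂ) - (i : ℕ)) / ((n : ℂ) + 1)) • T i.castSucc

theorem exists_torus_eq_character {n : ℕ} {T : Fin n → K →L[ℂ] K} (hT : IsGammaUnitary T)
    (χ : WeakDual.characterSpace ℂ (cstar T)) :
    ∃ ζ : Fin n → ℂ, (∀ i, ‖ζ i‖ = 1) ∧ ∀ i, χ ⟨T i, mem_cstar T i⟩ = symmetrization n ζ i := by
  have h : (fun i => χ ⟨T i, mem_cstar T i⟩) ∈ distinguishedBoundary n :=
    hT.2.2 ⟨χ, fun _ => rfl⟩
  rw [distinguishedBoundary_eq] at h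
  obtain ⟨ζ, hζ, h⟩ := h
  exact ⟨ζ, hζ, fun i => (congrFun h i).symm⟩

theorem IsGammaUnitary.castSucc_eq {n : ℕ} {T : Fin (n + 1) → K →L[ℂ] K}
    (hT : IsGammaUnitary T) (i : Fin n) :
    T i.castSucc = star (T i.rev.castSucc) * T (Fin.last n) := by
  let t : Fin (n + 1) → cstar T := fun i => ⟨T i, mem_cstar T i⟩
  have h : t i.castSucc = star (t i.rev.castSucc) * t (Fin.last n) := by
    refine eq_of_forall_character hT.1 hT.2.1 fun χ => ?_
    obtain ⟨ζ, hζ, h⟩ := exists_torus_eq_character hT χ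
    rw [map_mul, map_star, show χ (t (Fin.last n)) = _ from h _,
      show χ (t i.castSucc) = _ from h _, show χ (t i.rev.castSucc) = _ from h _, RCLike.star_def]
    exact symmetrization_torus_self_inversive hζ i
  exact congrArg Subtype.val h

theorem IsGammaUnitary.norm_polyEval_derivTuple_le {n : ℕ} {T : Fin (n + 1) → K →L[ℂ] K}
    (hT : IsGammaUnitary T) (p : MvPolynomial (Fin n) ℂ) :
    ‖polyEval p (derivTuple T)‖ ≤ sSup ((fun z => ‖MvPolynomial.eval z p‖) '' Gamma n) := by
  let s : Fin n → cstar T := fun i =>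
    (((n : ℂ) - (i : ℕ)) / ((n : ℂ) + 1)) • ⟨T i.castSucc, mem_cstar T i.castSucc⟩
  obtain ⟨b, hb, hχ⟩ := exists_coe_eq_polyEval (cstar T) s p
  have hs : derivTuple T = fun i => (s i : K →L[ℂ] K) := rfl
  rw [hs, ← hb]
  refine norm_le_of_forall_character hT.1 hT.2.1 b (sSup_norm_eval_Gamma_nonneg p) fun χ => ?_
  obtain ⟨ζ, hζ, h⟩ := exists_torus_eq_character hT χ
  have h1 : χ b = MvPolynomial.eval (fun i => χ (s i)) p :=
    hχ (WeakDual.CharacterSpace.toAlgHom χ)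
  have h2 : (fun i => χ (s i)) = derivCoords (symmetrization (n + 1) ζ) := by
    ext i
    rw [show χ (s i) = (((n : ℂ) - (i : ℕ)) / ((n : ℂ) + 1)) *
      χ ⟨T i.castSucc, mem_cstar T i.castSucc⟩ from map_smul χ _ _, h]
    rfl
  rw [h1, h2]
  exact norm_eval_le_sSup_Gamma p (derivCoords_mem_Gamma ⟨ζ, fun i => (hζ i).le, rfl⟩)

end Unitary

section

open ContinuousLinearMap

/-! ### The Wold decomposition of a pure isometry -/

section Wold

variable {H : Type u} [NormedAddCommGroup H] [InnerProductSpace ℂ H] [CompleteSpace H]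

/-- The wandering subspace `ker V* = (V H)ᗮ` of an isometry `V`. -/
def wanderingSubspace (V : H →L[ℂ] H) : Submodule ℂ H := (adjoint V).ker

instance (V : H →L[ℂ] H) : CompleteSpace (wanderingSubspace V) :=
  inferInstanceAs (CompleteSpace (adjoint V).ker)

/-- The `k`-th coefficient `P V*ᵏ x` of a vector `x` in the Wold decomposition, where `P` is the
orthogonal projection onto the wandering subspace. -/
def woldCoeff (V : H →L[ℂ] H) (k : ℕ) : H →L[ℂ] wanderingSubspace V :=
  (wanderingSubspace V).orthogonalProjectionOnto ∘L (adjoint V) ^ k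

/-- The compression of an operator to the wandering subspace. -/
def compression (V S : H →L[ℂ] H) : wanderingSubspace V →L[ℂ] wanderingSubspace V :=
  woldCoeff V 0 ∘L S ∘L (wanderingSubspace V).subtypeL

variable {V : H →L[ℂ] H}

theorem adjoint_coe_wandering (e : wanderingSubspace V) : adjoint V (e : H) = 0 := e.2

theorem adjoint_apply_apply (hV : Isometry V) (x : H) : adjoint V (V x) = x := by
  have h := (V.norm_map_iff_adjoint_comp_self).1
    ((AddMonoidHomClass.isometry_iff_norm V).1 hV)
  exact congrArg (fun T : H →L[ℂ] H => T x) h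

theorem woldCoeff_zero_apply (x : H) :
    woldCoeff V 0 x = (wanderingSubspace V).orthogonalProjectionOnto x := by
  rw [woldCoeff, pow_zero]
  rfl

theorem woldCoeff_zero_map (x : H) : woldCoeff V 0 (V x) = 0 := by
  rw [woldCoeff_zero_apply, Submodule.orthogonalProjectionOnto_eq_zero_iff]
  intro e he
  rw [← adjoint_inner_left, show adjoint V e = 0 from he, inner_zero_left]

theorem woldCoeff_succ (k : ℕ) (x : H) :
    woldCoeff V (k + 1) x = woldCoeff V k (adjoint V x) := by
  simp only [woldCoeff, pow_succ, comp_apply, mul_apply_eq_comp]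

theorem woldCoeff_eq (k : ℕ) (x : H) :
    woldCoeff V k x = woldCoeff V 0 ((adjoint V ^ k) x) := by
  rw [woldCoeff_zero_apply]
  rfl

theorem woldCoeff_zero_coe (e : wanderingSubspace V) : woldCoeff V 0 (e : H) = e := by
  rw [woldCoeff_zero_apply]
  exact Submodule.orthogonalProjectionOnto_mem_subspace_eq_self e

/-- The orthogonal decomposition of `H` into the wandering subspace and the range of `V`. -/
theorem eq_woldCoeff_zero_add (hV : Isometry V) (x : H) :
    x = (woldCoeff V 0 x : H) + V (adjoint V x) := by
  have hmem : x - V (adjoint V x) ∈ wanderingSubspace V := by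
    change adjoint V (x - V (adjoint V x)) = 0
    rw [map_sub, adjoint_apply_apply hV, sub_self]
  have h : woldCoeff V 0 x = ⟨x - V (adjoint V x), hmem⟩ := by
    conv_lhs => rw [← sub_add_cancel x (V (adjoint V x)), map_add, woldCoeff_zero_map, add_zero]
    exact woldCoeff_zero_coe ⟨_, hmem⟩
  rw [h]
  simp

theorem woldCoeff_pow_coe (hV : Isometry V) (j k : ℕ) (e : wanderingSubspace V) :
    woldCoeff V k ((V ^ j) (e : H)) = if j = k then e else 0 := by
  induction j generalizing k with
  | zero =>
    cases k with
    | zero => simpa using woldCoeff_zero_coe e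
    | succ k => rw [woldCoeff_succ]; simp [adjoint_coe_wandering]
  | succ j ih =>
    rw [pow_succ', mul_apply_eq_comp]
    cases k with
    | zero => rw [woldCoeff_zero_map]; simp
    | succ k => rw [woldCoeff_succ, adjoint_apply_apply hV, ih]; simp

theorem inner_pow_coe (k : ℕ) (e : wanderingSubspace V) (x : H) :
    inner ℂ ((V ^ k) (e : H)) x = inner ℂ e (woldCoeff V k x) := by
  have h : ∀ (k : ℕ) (y z : H), inner ℂ ((V ^ k) y) z = inner ℂ y ((adjoint V ^ k) z) := by
    intro k
    induction k with
    | zero => intro y z; simp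
    | succ k ih =>
      intro y z
      rw [pow_succ, pow_succ', mul_apply_eq_comp, ih, mul_apply_eq_comp, adjoint_inner_right]
  rw [h, woldCoeff_eq, woldCoeff_zero_apply]
  exact (Submodule.inner_orthogonalProjectionOnto_eq_of_mem_left _ _).symm

/-- The isometric embedding `e ↦ Vᵏ e` of the wandering subspace. -/
def woldEmbedding (hV : Isometry V) (k : ℕ) : wanderingSubspace V →ₗᵢ[ℂ] H where
  toLinearMap := ((V ^ k) ∘L (wanderingSubspace V).subtypeL).toLinearMap
  norm_map' e := by
    have h : ∀ (k : ℕ) (x : H), ‖(V ^ k) x‖ = ‖x‖ := by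
      intro k
      induction k with
      | zero => simp
      | succ k ih =>
        intro x
        rw [pow_succ, mul_apply_eq_comp, ih, (AddMonoidHomClass.isometry_iff_norm V).1 hV]
    exact h k e

theorem isHilbertSum_wold (hV : IsPureIsometry V) :
    IsHilbertSum ℂ (fun _ : ℕ => wanderingSubspace V) (woldEmbedding hV.1) := by
  have hin : ∀ k (e : wanderingSubspace V) (x : H),
      inner ℂ (woldEmbedding hV.1 k e) x = inner ℂ e (woldCoeff V k x) := fun k e x =>
    inner_pow_coe k e x
  refine IsHilbertSum.mk (fun i j hij e f => ?_) ?_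
  · rw [hin, show woldEmbedding hV.1 j f = (V ^ j) (f : H) from rfl, woldCoeff_pow_coe hV.1,
      if_neg hij.symm, inner_zero_right]
  · rw [top_le_iff, Submodule.topologicalClosure_eq_top_iff, Submodule.eq_bot_iff]
    intro x hx
    have hzero : ∀ k, woldCoeff V k x = 0 := by
      intro k
      have h1 := hx _ (Submodule.mem_iSup_of_mem k
        (LinearMap.mem_range_self (woldEmbedding hV.1 k).toLinearMap (woldCoeff V k x)))
      exact inner_self_eq_zero.1 ((hin k _ x).symm.trans h1)
    have hx' : ∀ k, (V ^ k) ((adjoint V ^ k) x) = x := by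
      intro k
      induction k with
      | zero => simp
      | succ k ih =>
        have h2 := eq_woldCoeff_zero_add hV.1 ((adjoint V ^ k) x)
        rw [← woldCoeff_eq, hzero, Submodule.coe_zero, zero_add] at h2
        rw [pow_succ, pow_succ', mul_apply_eq_comp, mul_apply_eq_comp, ← h2, ih]
    have hmem : x ∈ ⨅ k : ℕ, (V ^ k).toLinearMap.range := by
      rw [Submodule.mem_iInf]
      exact fun k => ⟨_, hx' k⟩
    rw [hV.2] at hmem
    exact hmem

/-- The unitary operator of `H` onto the Hardy space of the wandering subspace that maps `Vᵏ e` to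
`zᵏ e`. -/
def woldUnitary (hV : IsPureIsometry V) : H ≃ₗᵢ[ℂ] HardySpace (wanderingSubspace V) :=
  (isHilbertSum_wold hV).linearIsometryEquiv.trans
    (HardySpace.taylorEquiv (wanderingSubspace V)).symm

theorem hasSum_woldUnitary (hV : IsPureIsometry V) (x : H) (z : Disc) :
    HasSum (fun k => (z : ℂ) ^ k • woldCoeff V k x) (woldUnitary hV x z) := by
  have h1 : HardySpace.taylor (woldUnitary hV x) = (isHilbertSum_wold hV).linearIsometryEquiv x :=
    (HardySpace.taylorEquiv (wanderingSubspace V)).apply_symm_apply _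
  have h2 : ∀ k, HardySpace.taylor (woldUnitary hV x) k = woldCoeff V k x := by
    intro k
    have h3 := ((isHilbertSum_wold hV).hasSum_linearIsometryEquiv_symm
      ((isHilbertSum_wold hV).linearIsometryEquiv x)).mapL (woldCoeff V k)
    rw [LinearIsometryEquiv.symm_apply_apply, ← h1] at h3
    refine (h3.unique ?_).symm
    convert hasSum_ite_eq k (HardySpace.taylor (woldUnitary hV x) k) using 2 with j
    refine (woldCoeff_pow_coe hV.1 j k _).trans ?_
    split_ifs with h
    · rw [h]
    · rfl
  simpa only [h2] using HardySpace.hasSum_taylor (woldUnitary hV x) z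

theorem woldCoeff_zero_commuting (hV : Isometry V) {S : H →L[ℂ] H} (hS : Commute S V) (x : H) :
    woldCoeff V 0 (S x) = compression V S (woldCoeff V 0 x) := by
  conv_lhs => rw [eq_woldCoeff_zero_add hV x, map_add, show S (V (adjoint V x)) = V (S (adjoint V x))
    from congrArg (fun T : H →L[ℂ] H => T (adjoint V x)) hS.eq, map_add, woldCoeff_zero_map,
    add_zero]
  rfl

/-- In terms of the Wold coefficients, an operator `S = S'* V`, with `S` and `S'` commuting
with `V`, acts as `a_k ↦ A a_k + A'* a_{k-1}`, where `A` and `A'` are the compressions of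
`S` and `S'` to the wandering subspace. -/
theorem woldCoeff_succ_commuting (hV : Isometry V) {S S' : H →L[ℂ] H} (hS : Commute S V)
    (hS' : Commute S' V) (h : S = adjoint S' * V) (k : ℕ) (x : H) :
    woldCoeff V (k + 1) (S x) = compression V S (woldCoeff V (k + 1) x) +
      adjoint (compression V S') (woldCoeff V k x) := by
  have hadj : Commute (adjoint S') (adjoint V) := by
    have := hS'.star_star
    rwa [star_eq_adjoint, star_eq_adjoint] at this
  have h1 : adjoint V (S x) = adjoint S' x := by
    rw [h, mul_apply_eq_comp, ← mul_apply_eq_comp, ← hadj.eq, mul_apply_eq_comp,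
      adjoint_apply_apply hV]
  have h2 : adjoint (compression V S') = woldCoeff V 0 ∘L adjoint S' ∘L
      (wanderingSubspace V).subtypeL := by
    rw [compression, adjoint_comp, adjoint_comp, Submodule.adjoint_subtypeL]
    simp only [woldCoeff, pow_zero, one_def, comp_id, Submodule.adjoint_orthogonalProjectionOnto]
    rfl
  set y := (adjoint V ^ k) x with hy
  have h3 : adjoint V y = (adjoint V ^ (k + 1)) x := by rw [pow_succ', mul_apply_eq_comp]
  have h4 : (adjoint V ^ k) (adjoint S' x) = adjoint S' y :=
    congrArg (fun T : H →L[ℂ] H => T x) (hadj.symm.pow_left k).eq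
  rw [woldCoeff_succ, h1, woldCoeff_eq, h4]
  conv_lhs => rw [eq_woldCoeff_zero_add hV y, map_add, map_add,
    show adjoint S' (V (adjoint V y)) = S (adjoint V y) by rw [h, mul_apply_eq_comp],
    woldCoeff_zero_commuting hV hS, h3]
  rw [woldCoeff_eq (k + 1), woldCoeff_eq k, h2, add_comm]
  rfl

theorem hasSum_shift {E : Type*} [NormedAddCommGroup E] [NormedSpace ℂ E] {a b : ℕ → E} {z : ℂ}
    {x y : E} (h0 : b 0 = 0) (hsucc : ∀ k, b (k + 1) = a k)
    (ha : HasSum (fun k => z ^ k • a k) x) (hb : HasSum (fun k => z ^ k • b k) y) : y = z • x := by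
  have h1 : HasSum (fun k => z ^ (k + 1) • b (k + 1)) (z • x) := by
    convert ha.const_smul z using 2 with k
    rw [hsucc, pow_succ', mul_smul]
  have h2 := (hasSum_nat_add_iff (f := fun k => z ^ k • b k) 1).1 h1
  simp only [Finset.range_one, Finset.sum_singleton, h0, smul_zero, add_zero] at h2
  exact hb.unique h2

theorem woldUnitary_shift_apply (hV : IsPureIsometry V) (x : H) (z : Disc) :
    woldUnitary hV (V x) z = (z : ℂ) • woldUnitary hV x z :=
  hasSum_shift (woldCoeff_zero_map x)
    (fun k => by rw [woldCoeff_succ, adjoint_apply_apply hV.1])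
    (hasSum_woldUnitary hV x z) (hasSum_woldUnitary hV (V x) z)

theorem woldUnitary_commuting_apply (hV : IsPureIsometry V) {S S' : H →L[ℂ] H} (hS : Commute S V)
    (hS' : Commute S' V) (h : S = adjoint S' * V) (x : H) (z : Disc) :
    woldUnitary hV (S x) z =
      (compression V S + (z : ℂ) • adjoint (compression V S')) (woldUnitary hV x z) := by
  have h1 := (hasSum_woldUnitary hV x z).mapL (compression V S)
  have h2 := (hasSum_woldUnitary hV x z).mapL (adjoint (compression V S'))
  have h3 := hasSum_woldUnitary hV (S x) z
  simp only [map_smul] at h1 h2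
  have h4 := h3.sub h1
  simp only [← smul_sub] at h4
  have h5 := hasSum_shift (a := fun k => adjoint (compression V S') (woldCoeff V k x))
    (b := fun k => woldCoeff V k (S x) - compression V S (woldCoeff V k x))
    (by simp only [woldCoeff_zero_commuting hV.1 hS, sub_self])
    (fun k => by simp only [woldCoeff_succ_commuting hV.1 hS hS' h, add_sub_cancel_left]) h2 h4
  rw [_root_.add_apply, _root_.smul_apply, ← h5]
  abel

end Wold

/-! ### Point evaluations on the Hardy space -/

section Kernel

variable {E : Type u} [NormedAddCommGroup E] [InnerProductSpace ℂ E] [CompleteSpace E]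

/-- The reproducing kernel of `H²(E)`: evaluation at `z` paired with `e` is the inner product with
`f(w) = ∑ₖ wᵏ z̄ᵏ e`, whose value at `z` is `e / (1 - |z|²)`. -/
theorem exists_kernel (z : Disc) (e : E) : ∃ f : HardySpace E,
    (∀ g : HardySpace E, inner ℂ f g = inner ℂ e (g z)) ∧
      f z = ((1 - ‖(z : ℂ)‖ ^ 2)⁻¹ : ℂ) • e := by
  have hz : ‖(z : ℂ)‖ < 1 := mem_ball_zero_iff.1 z.2
  have hmem : Memℓp (fun k : ℕ => (starRingEnd ℂ) (z : ℂ) ^ k • e) 2 := by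
    refine memℓp_gen ?_
    have hs := (summable_geometric_of_lt_one (sq_nonneg ‖(z : ℂ)‖)
      (pow_lt_one₀ (norm_nonneg _) hz two_ne_zero)).mul_right (‖e‖ ^ 2)
    refine hs.congr fun k => ?_
    simp only [norm_smul, norm_pow, RCLike.norm_conj, ENNReal.toReal_ofNat, Real.rpow_ofNat]
    ring
  obtain ⟨f, hf⟩ := HardySpace.taylor_surjective (E := E) ⟨_, hmem⟩
  have hf' : ∀ k, HardySpace.taylor f k = (starRingEnd ℂ) (z : ℂ) ^ k • e := fun k =>
    congrArg (fun a : lp (fun _ : ℕ => E) 2 => a k) hf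
  refine ⟨f, fun g => ?_, ?_⟩
  · have h1 := ((HardySpace.hasSum_taylor g z).mapL (innerSL ℂ e)).tsum_eq
    simp only [innerSL_apply_apply] at h1
    rw [HardySpace.inner_eq, ← h1]
    refine tsum_congr fun k => ?_
    rw [hf', inner_smul_left, inner_smul_right, map_pow, Complex.conj_conj]
  · have h1 := HardySpace.hasSum_taylor f z
    simp only [hf', smul_smul, ← mul_pow, Complex.mul_conj, Complex.normSq_eq_norm_sq] at h1
    have h2 : HasSum (fun k : ℕ => ((‖(z : ℂ)‖ ^ 2 : ℝ) : ℂ) ^ k)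
        (1 - ((‖(z : ℂ)‖ ^ 2 : ℝ) : ℂ))⁻¹ := by
      refine hasSum_geometric_of_norm_lt_one ?_
      rw [Complex.norm_real, Real.norm_of_nonneg (sq_nonneg _)]
      exact pow_lt_one₀ (norm_nonneg _) hz two_ne_zero
    have h3 := h1.unique (h2.smul_const e)
    rw [h3]
    push_cast
    rfl

theorem one_sub_norm_sq_pos (z : Disc) : 0 < 1 - ‖(z : ℂ)‖ ^ 2 := by
  have hz : ‖(z : ℂ)‖ < 1 := mem_ball_zero_iff.1 z.2
  have := pow_lt_one₀ (norm_nonneg _) hz two_ne_zero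
  linarith

theorem exists_apply_eq (z : Disc) (e : E) : ∃ f : HardySpace E, f z = e := by
  obtain ⟨f, -, hf⟩ := exists_kernel z e
  have hne : (1 - (‖(z : ℂ)‖ : ℂ) ^ 2) ≠ 0 := by exact_mod_cast (one_sub_norm_sq_pos z).ne'
  refine ⟨(1 - (‖(z : ℂ)‖ : ℂ) ^ 2) • f, ?_⟩
  change (1 - (‖(z : ℂ)‖ : ℂ) ^ 2) • f z = e
  rw [hf, smul_smul, mul_inv_cancel₀ hne, one_smul]

/-- The values of an operator-valued multiplier are bounded by the norm of the
multiplication operator. -/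
theorem norm_le_of_apply_eq (z : Disc) {q : E →L[ℂ] E} {Q : HardySpace E → HardySpace E} {c : ℝ}
    (hc : 0 ≤ c) (hQ : ∀ f, ‖Q f‖ ≤ c * ‖f‖) (h : ∀ f, Q f z = q (f z)) : ‖q‖ ≤ c := by
  refine opNorm_le_bound _ hc fun e => ?_
  set d : ℝ := (1 - ‖(z : ℂ)‖ ^ 2)⁻¹ with hd
  have hdpos : 0 < d := inv_pos.2 (one_sub_norm_sq_pos z)
  have hdc : ((1 - (‖(z : ℂ)‖ : ℂ) ^ 2)⁻¹ : ℂ) = (d : ℂ) := by rw [hd]; push_cast; rfl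
  obtain ⟨f, hf, hfz⟩ := exists_kernel z e
  obtain ⟨g, hg, hgz⟩ := exists_kernel z (q e)
  rw [hdc] at hfz hgz
  have hnorm : ∀ {k : HardySpace E} {v : E}, (∀ g : HardySpace E, inner ℂ k g = inner ℂ v (g z)) →
      k z = (d : ℂ) • v → ‖k‖ ^ 2 = d * ‖v‖ ^ 2 := by
    intro k v h1 h2
    have h3 := h1 k
    rw [h2, inner_smul_right, inner_self_eq_norm_sq_to_K, inner_self_eq_norm_sq_to_K] at h3
    have h4 : ((‖k‖ ^ 2 : ℝ) : ℂ) = ((d * ‖v‖ ^ 2 : ℝ) : ℂ) := by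
      push_cast
      exact h3
    exact_mod_cast h4
  have hfn := hnorm hf hfz
  have hgn := hnorm hg hgz
  have h1 : d * ‖q e‖ ^ 2 ≤ ‖g‖ * (c * ‖f‖) := by
    have h2 := hg (Q f)
    rw [h, hfz, map_smul, inner_smul_right, inner_self_eq_norm_sq_to_K] at h2
    have h3 := norm_inner_le_norm (𝕜 := ℂ) g (Q f)
    have h4 : ‖inner ℂ g (Q f)‖ = d * ‖q e‖ ^ 2 := by
      rw [h2, norm_mul, norm_pow]
      simp [abs_of_pos hdpos]
    rw [← h4]
    exact h3.trans (mul_le_mul_of_nonneg_left (hQ f) (norm_nonneg _))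
  have h2 : (‖g‖ * ‖f‖) = d * (‖q e‖ * ‖e‖) := by
    refine (sq_eq_sq₀ (by positivity) (by positivity)).1 ?_
    rw [mul_pow, hfn, hgn]
    ring
  have h3 : d * ‖q e‖ ^ 2 ≤ d * (c * (‖q e‖ * ‖e‖)) := by
    calc d * ‖q e‖ ^ 2 ≤ c * (‖g‖ * ‖f‖) := by linarith
      _ = d * (c * (‖q e‖ * ‖e‖)) := by rw [h2]; ring
  have h4 := le_of_mul_le_mul_left h3 hdpos
  rcases (norm_nonneg (q e)).eq_or_lt with h0 | h0
  · rw [← h0]; positivity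
  · nlinarith

end Kernel

/-! ### Operator pencils -/

/-- Pencils `a + w b` and `c + w d` with a central parameter `w` commute as soon as their
coefficients satisfy the commutation relations obtained by comparing powers of `w`. -/
theorem commute_pencil {R : Type*} [Ring R] {a b c d w : R} (hac : a * c - c * a = 0)
    (hbd : Commute b d) (hcross : a * d - d * a = c * b - b * c) (ha : Commute w a)
    (hb : Commute w b) (hc : Commute w c) (hd : Commute w d) :
    Commute (a + w * b) (c + w * d) := by
  rw [commute_iff_eq, add_mul, add_mul, mul_add, mul_add, mul_add, mul_add,
    sub_eq_zero.1 hac]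
  have h1 : a * (w * d) = w * (a * d) := by rw [← mul_assoc, ← ha.eq, mul_assoc]
  have h2 : c * (w * b) = w * (c * b) := by rw [← mul_assoc, ← hc.eq, mul_assoc]
  have h3 : w * b * (w * d) = w * w * (b * d) := by
    rw [mul_assoc, ← mul_assoc b, ← hb.eq, mul_assoc w b, mul_assoc w w]
  have h4 : w * d * (w * b) = w * w * (b * d) := by
    rw [mul_assoc, ← mul_assoc d, ← hd.eq, mul_assoc w d, mul_assoc w w, hbd.eq]
  rw [h1, h2, h3, h4]
  have h5 : w * (a * d) + w * (b * c) = w * (c * b) + w * (d * a) := by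
    rw [← mul_add, ← mul_add]
    congr 1
    rw [sub_eq_sub_iff_add_eq_add] at hcross
    rw [hcross]
  rw [mul_assoc w b c, mul_assoc w d a]
  calc c * a + w * (a * d) + (w * (b * c) + w * w * (b * d))
      = c * a + (w * (a * d) + w * (b * c)) + w * w * (b * d) := by abel
    _ = _ := by rw [h5]; abel

theorem commutation_of_commute_pencil {R : Type*} [Ring R] [Algebra ℂ R] {a b c d : R}
    (h : ∀ z : ℂ, ‖z‖ < 1 → Commute (a + z • b) (c + z • d)) :
    a * c - c * a = 0 ∧ a * d - d * a = c * b - b * c := by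
  have h0 := (h 0 (by simp)).eq
  have h1 := (h (1 / 2) (by norm_num)).eq
  have h2 := (h (-(1 / 2)) (by norm_num)).eq
  simp only [zero_smul, add_zero] at h0
  refine ⟨sub_eq_zero.2 h0, ?_⟩
  have h3 : ∀ a b c d : R, a * d + b * c = (a + (1 / 2 : ℂ) • b) * (c + (1 / 2 : ℂ) • d) -
      (a + (-(1 / 2) : ℂ) • b) * (c + (-(1 / 2) : ℂ) • d) := by
    intro a b c d
    simp only [add_mul, mul_add, smul_mul_assoc, mul_smul_comm]
    module
  rw [sub_eq_sub_iff_add_eq_add, h3 a b c d, h1, h2, ← h3 c d a b]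

/-! ### The model of a pure `Γ_n`-isometry -/

section Forward

variable {H : Type u} [NormedAddCommGroup H] [InnerProductSpace ℂ H]

theorem IsGammaIsometry.castSucc_eq [CompleteSpace H] {n : ℕ} {S : Fin (n + 1) → H →L[ℂ] H}
    (hS : IsGammaIsometry S) (i : Fin n) :
    S i.castSucc = adjoint (S i.rev.castSucc) * S (Fin.last n) := by
  obtain ⟨K, _, _, _, J, T, hT, hJ⟩ := hS
  ext x
  refine ext_inner_right ℂ fun y => ?_
  rw [mul_apply_eq_comp, adjoint_inner_left, ← J.inner_map_map, ← J.inner_map_map, ← hJ, ← hJ,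
    ← hJ, hT.castSucc_eq, mul_apply_eq_comp, star_eq_adjoint, adjoint_inner_left]

theorem IsGammaIsometry.norm_polyEval_derivTuple_apply_le {n : ℕ} {S : Fin (n + 1) → H →L[ℂ] H}
    (hS : IsGammaIsometry S) (p : MvPolynomial (Fin n) ℂ) (x : H) :
    ‖polyEval p (derivTuple S) x‖ ≤
      sSup ((fun z => ‖MvPolynomial.eval z p‖) '' Gamma n) * ‖x‖ := by
  obtain ⟨K, _, _, _, J, T, hT, hJ⟩ := hS
  have h := map_polyEval p (S := derivTuple S) (S' := derivTuple T) J.toLinearMap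
    (fun i x => by
      change J ((((n : ℂ) - (i : ℕ)) / ((n : ℂ) + 1)) • S i.castSucc x) =
        (((n : ℂ) - (i : ℕ)) / ((n : ℂ) + 1)) • T i.castSucc (J x)
      rw [map_smul, hJ]) x
  change J _ = polyEval p (derivTuple T) (J x) at h
  rw [← J.norm_map, h, ← J.norm_map x]
  exact le_of_opNorm_le _ (hT.norm_polyEval_derivTuple_le p) _

variable [CompleteSpace H]

/-- The symbol `Φᵢ(z) = Aᵢ + z A*ₙ₊₁₋ᵢ`, in terms of one-based indices `i ≤ n`, for which
`Fin.rev` is the reflection `i ↦ n + 1 - i`. -/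
def symbol {E : Type*} [NormedAddCommGroup E] [InnerProductSpace ℂ E] [CompleteSpace E] {n : ℕ}
    (A : Fin n → E →L[ℂ] E) (i : Fin n) (z : ℂ) : E →L[ℂ] E :=
  A i + z • adjoint (A i.rev)

theorem continuous_symbol {E : Type*} [NormedAddCommGroup E] [InnerProductSpace ℂ E]
    [CompleteSpace E] {n : ℕ} (A : Fin n → E →L[ℂ] E) (i : Fin n) : Continuous (symbol A i) := by
  unfold symbol
  fun_prop

theorem inHInfty_symbol {E : Type u} [NormedAddCommGroup E] [InnerProductSpace ℂ E]
    [CompleteSpace E] {n : ℕ} (A : Fin n → E →L[ℂ] E) (i : Fin n) : InHInfty (symbol A i) := by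
  refine ⟨?_, ‖A i‖ + ‖adjoint (A i.rev)‖, fun z hz => ?_⟩
  · unfold symbol
    fun_prop
  · refine (norm_add_le _ _).trans (add_le_add le_rfl ?_)
    rw [norm_smul]
    exact mul_le_of_le_one_left (norm_nonneg _) (mem_ball_zero_iff.1 hz).le

theorem commute_symbol {E : Type*} [NormedAddCommGroup E] [InnerProductSpace ℂ E]
    [CompleteSpace E] {n : ℕ} {A : Fin n → E →L[ℂ] E} (h1 : ∀ i j, A i * A j - A j * A i = 0)
    (h2 : ∀ i j, A i * adjoint (A j.rev) - adjoint (A j.rev) * A i =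
      A j * adjoint (A i.rev) - adjoint (A i.rev) * A j) (i j : Fin n) (z : ℂ) :
    Commute (symbol A i z) (symbol A j z) := by
  have h := commute_pencil (a := A i) (b := adjoint (A i.rev)) (c := A j)
    (d := adjoint (A j.rev)) (w := algebraMap ℂ (E →L[ℂ] E) z) (h1 i j) ?_ (h2 i j)
    (Algebra.commutes z _) (Algebra.commutes z _) (Algebra.commutes z _) (Algebra.commutes z _)
  · rwa [← Algebra.smul_def, ← Algebra.smul_def] at h
  · have hc : Commute (A i.rev) (A j.rev) := sub_eq_zero.1 (h1 _ _)
    have := hc.star_star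
    rwa [star_eq_adjoint, star_eq_adjoint] at this

theorem norm_polyEval_symbol_le {E : Type*} [NormedAddCommGroup E] [InnerProductSpace ℂ E]
    [CompleteSpace E] {n : ℕ} (A : Fin n → E →L[ℂ] E) (p : MvPolynomial (Fin n) ℂ) {c : ℝ}
    (h : ∀ z : ℂ, ‖z‖ < 1 →
      ‖polyEval p (fun i => (((n : ℂ) - (i : ℕ)) / ((n : ℂ) + 1)) • symbol A i z)‖ ≤ c)
    {z : ℂ} (hz : ‖z‖ ≤ 1) :
    ‖polyEval p (fun i => (((n : ℂ) - (i : ℕ)) / ((n : ℂ) + 1)) • symbol A i z)‖ ≤ c := by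
  have hcont := (continuous_polyEval p
    (X := fun z i => (((n : ℂ) - (i : ℕ)) / ((n : ℂ) + 1)) • symbol A i z)
    fun i => (continuous_symbol A i).fun_const_smul _).norm
  have hcl := isClosed_le hcont (continuous_const (y := c))
  have hsub := closure_minimal (s := Metric.ball (0 : ℂ) 1)
    (fun z hz => h z (mem_ball_zero_iff.1 hz)) hcl
  rw [closure_ball _ one_ne_zero] at hsub
  exact hsub (mem_closedBall_zero_iff.2 hz)

theorem exists_model_of_isPureGammaIsometry [TopologicalSpace.SeparableSpace H] {n : ℕ}
    {S : Fin (n + 1) → H →L[ℂ] H} (hcomm : ∀ i j, Commute (S i) (S j))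
    (hS : IsPureGammaIsometry S) :
    ∃ (E : Type u) (_ : NormedAddCommGroup E) (_ : InnerProductSpace ℂ E)
      (_ : CompleteSpace E) (_ : TopologicalSpace.SeparableSpace E)
      (U : H ≃ₗᵢ[ℂ] HardySpace E) (Φ : Fin n → ℂ → E →L[ℂ] E) (A : Fin n → E →L[ℂ] E),
      (∀ i, InHInfty (Φ i)) ∧
      (∀ i : Fin n, IsMulOperator (conjBy U (S i.castSucc)) (Φ i)) ∧
      IsMulOperator (conjBy U (S (Fin.last n))) (fun z => z • ContinuousLinearMap.id ℂ E) ∧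
      (∀ z : ℂ, ‖z‖ = 1 → IsGammaContraction
        (fun i : Fin n => (((n : ℂ) - (i : ℕ)) / ((n : ℂ) + 1)) • Φ i z)) ∧
      (∀ (i : Fin n) (z : ℂ), ‖z‖ ≤ 1 → Φ i z = A i + z • adjoint (A i.rev)) ∧
      (∀ i j : Fin n, A i * A j - A j * A i = 0) ∧
      (∀ i j : Fin n, A i * adjoint (A j.rev) - adjoint (A j.rev) * A i =
        A j * adjoint (A i.rev) - adjoint (A i.rev) * A j) := by
  obtain ⟨hiso, hpure⟩ := hS
  set V := S (Fin.last n) with hVdef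
  let A : Fin n → wanderingSubspace V →L[ℂ] wanderingSubspace V := fun i =>
    compression V (S i.castSucc)
  let U := woldUnitary hpure
  have hsep : TopologicalSpace.SeparableSpace (wanderingSubspace V) := by
    have : SecondCountableTopology H := UniformSpace.secondCountable_of_separable H
    infer_instance
  have hmul : ∀ (i : Fin n) (x : H) (z : Disc),
      U (S i.castSucc x) z = symbol A i z (U x z) := fun i x z =>
    woldUnitary_commuting_apply hpure (hcomm _ _) (hcomm _ _) (hiso.castSucc_eq i) x z
  have hcommDisc : ∀ (i j : Fin n) (z : ℂ), ‖z‖ < 1 → Commute (symbol A i z) (symbol A j z) := by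
    intro i j z hz
    let w : Disc := ⟨z, mem_ball_zero_iff.2 hz⟩
    refine ContinuousLinearMap.ext fun e => ?_
    obtain ⟨f, rfl⟩ := exists_apply_eq w e
    obtain ⟨x, rfl⟩ := U.surjective f
    have h : ∀ i j, symbol A i z (symbol A j z (U x w)) =
        U ((S i.castSucc * S j.castSucc) x) w := fun i j => by
      rw [mul_apply_eq_comp, hmul i _ w, hmul j _ w]
    refine (h i j).trans (Eq.trans ?_ (h j i).symm)
    rw [(hcomm i.castSucc j.castSucc).eq]
  have hrel := fun i j => commutation_of_commute_pencil (hcommDisc i j)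
  have hbound : ∀ (p : MvPolynomial (Fin n) ℂ) (z : ℂ), ‖z‖ ≤ 1 →
      ‖polyEval p (fun i => (((n : ℂ) - (i : ℕ)) / ((n : ℂ) + 1)) • symbol A i z)‖ ≤
        sSup ((fun z => ‖MvPolynomial.eval z p‖) '' Gamma n) := by
    intro p z hz
    refine norm_polyEval_symbol_le A p (fun z hz => ?_) hz
    refine norm_le_of_apply_eq (⟨z, mem_ball_zero_iff.2 hz⟩ : Disc)
      (Q := fun f => U (polyEval p (derivTuple S) (U.symm f)))
      (sSup_norm_eval_Gamma_nonneg p) (fun f => ?_) fun f => ?_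
    · rw [U.norm_map, ← U.symm.norm_map f]
      exact hiso.norm_polyEval_derivTuple_apply_le p _
    · obtain ⟨x, rfl⟩ := U.surjective f
      rw [U.symm_apply_apply]
      let w : Disc := ⟨z, mem_ball_zero_iff.2 hz⟩
      let ev : H →ₗ[ℂ] wanderingSubspace V :=
        { toFun := fun x => U x w
          map_add' := fun x y => by rw [map_add]; rfl
          map_smul' := fun c x => by rw [map_smul]; rfl }
      refine map_polyEval p ev (fun i x => ?_) x
      refine (ev.map_smul (((n : ℂ) - (i : ℕ)) / ((n : ℂ) + 1)) (S i.castSucc x)).trans ?_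
      exact congrArg _ (hmul i x w)
  refine ⟨wanderingSubspace V, inferInstance, inferInstance, inferInstance, hsep, U, symbol A, A,
    inHInfty_symbol A, fun i f z => ?_, fun f z => ?_, fun z hz => ⟨fun i j => ?_, fun p => ?_⟩,
    fun i z _ => rfl, fun i j => (hrel i j).1, fun i j => (hrel i j).2⟩
  · obtain ⟨x, rfl⟩ := U.surjective f
    change U (S i.castSucc (U.symm (U x))) z = _
    rw [U.symm_apply_apply]
    exact hmul i x z
  · obtain ⟨x, rfl⟩ := U.surjective f
    change U (V (U.symm (U x))) z = _
    rw [U.symm_apply_apply]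
    exact woldUnitary_shift_apply hpure x z
  · exact ((commute_symbol (fun i j => (hrel i j).1) (fun i j => (hrel i j).2) i j z).smul_left
      _).smul_right _
  · exact hbound p z hz.le

end Forward

/-! ### Diagonal and shift operators on spaces of square-summable sequences -/

section Sequences

variable {E : Type u} [NormedAddCommGroup E] [InnerProductSpace ℂ E] {ι κ : Type}

/-- The diagonal operator `a ↦ (A aᵢ)ᵢ`, that is, `1 ⊗ A`. -/
def diagonalOp (ι : Type) (A : E →L[ℂ] E) : lp (fun _ : ι => E) 2 →L[ℂ] lp (fun _ : ι => E) 2 :=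
  lp.mapCLM 2 (fun _ => A) (norm_nonneg A) fun _ => le_rfl

theorem diagonalOp_apply (A : E →L[ℂ] E) (a : lp (fun _ : ι => E) 2) (i : ι) :
    diagonalOp ι A a i = A (a i) := rfl

theorem norm_diagonalOp_le (A : E →L[ℂ] E) : ‖diagonalOp ι A‖ ≤ ‖A‖ :=
  lp.norm_mapCLM_le 2 _ _ _

/-- `A ↦ 1 ⊗ A` as a ring homomorphism. -/
def diagonalHom (ι : Type) :
    (E →L[ℂ] E) →+* (lp (fun _ : ι => E) 2 →L[ℂ] lp (fun _ : ι => E) 2) where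
  toFun := diagonalOp ι
  map_one' := rfl
  map_mul' _ _ := rfl
  map_zero' := rfl
  map_add' _ _ := rfl

theorem diagonalOp_smul (c : ℂ) (A : E →L[ℂ] E) : diagonalOp ι (c • A) = c • diagonalOp ι A := rfl

theorem adjoint_diagonalOp [CompleteSpace E] (A : E →L[ℂ] E) :
    adjoint (diagonalOp ι A) = diagonalOp ι (adjoint A) := by
  symm
  rw [eq_adjoint_iff]
  intro a b
  rw [lp.inner_eq_tsum, lp.inner_eq_tsum]
  refine tsum_congr fun i => ?_
  rw [diagonalOp_apply, diagonalOp_apply, adjoint_inner_left]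

theorem memℓp_extend {F : Type*} [NormedAddCommGroup F] (e : ι ↪ κ)
    (a : lp (fun _ : ι => F) 2) : Memℓp (E := fun _ : κ => F) (Function.extend e a 0) 2 := by
  have ha := (memℓp_gen_iff (by norm_num)).1 (lp.memℓp a)
  rw [memℓp_gen_iff (by norm_num), ← e.injective.summable_iff]
  · convert ha using 2 with i
    simp [e.injective.extend_apply]
  · intro k hk
    rw [Function.extend_apply' _ _ _ hk]
    simp

/-- Extension of square-summable families by zero along an injection of the index sets. -/
def extendLp (e : ι ↪ κ) : lp (fun _ : ι => E) 2 →ₗᵢ[ℂ] lp (fun _ : κ => E) 2 where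
  toFun a := ⟨Function.extend e a 0, memℓp_extend e a⟩
  map_add' a b := by
    refine lp.ext (funext fun k => ?_)
    change Function.extend e (fun i => a i + b i) 0 k =
      Function.extend e a 0 k + Function.extend e b 0 k
    by_cases hk : ∃ i, e i = k
    · obtain ⟨i, rfl⟩ := hk
      simp only [e.injective.extend_apply]
    · simp [Function.extend_apply' _ _ _ hk]
  map_smul' c a := by
    refine lp.ext (funext fun k => ?_)
    change Function.extend e (fun i => c • a i) 0 k = c • Function.extend e a 0 k
    by_cases hk : ∃ i, e i = k
    · obtain ⟨i, rfl⟩ := hk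
      simp only [e.injective.extend_apply]
    · simp [Function.extend_apply' _ _ _ hk]
  norm_map' a := by
    change ‖(⟨Function.extend e a 0, memℓp_extend e a⟩ : lp (fun _ : κ => E) 2)‖ = ‖a‖
    rw [lp.norm_eq_tsum_rpow (by norm_num), lp.norm_eq_tsum_rpow (by norm_num)]
    congr 1
    rw [← e.injective.tsum_eq]
    · refine tsum_congr fun i => ?_
      simp [e.injective.extend_apply]
    · intro k hk
      by_contra hk'
      refine hk ?_
      change ‖Function.extend e a 0 k‖ ^ _ = 0
      rw [Function.extend_apply' _ _ _ hk']
      simp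

theorem extendLp_apply (e : ι ↪ κ) (a : lp (fun _ : ι => E) 2) (i : ι) :
    extendLp e a (e i) = a i :=
  e.injective.extend_apply _ _ _

theorem extendLp_apply_of_notMem (e : ι ↪ κ) (a : lp (fun _ : ι => E) 2) {k : κ}
    (hk : ¬∃ i, e i = k) : extendLp e a k = 0 :=
  Function.extend_apply' _ _ _ hk

theorem extendLp_extendLp {μ : Type} (e : ι ↪ κ) (f : κ ↪ μ) (a : lp (fun _ : ι => E) 2) :
    extendLp f (extendLp e a) = extendLp (e.trans f) a := by
  refine lp.ext (funext fun k => ?_)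
  by_cases hk : ∃ i, f i = k
  · obtain ⟨i, rfl⟩ := hk
    rw [extendLp_apply]
    by_cases hi : ∃ j, e j = i
    · obtain ⟨j, rfl⟩ := hi
      rw [extendLp_apply]
      exact (extendLp_apply (e.trans f) a j).symm
    · rw [extendLp_apply_of_notMem _ _ hi, extendLp_apply_of_notMem]
      rintro ⟨j, hj⟩
      exact hi ⟨j, f.injective hj⟩
  · rw [extendLp_apply_of_notMem _ _ hk, extendLp_apply_of_notMem]
    rintro ⟨j, hj⟩
    exact hk ⟨_, hj⟩

theorem diagonalOp_extendLp (A : E →L[ℂ] E) (e : ι ↪ κ) (a : lp (fun _ : ι => E) 2) :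
    diagonalOp κ A (extendLp e a) = extendLp e (diagonalOp ι A a) := by
  refine lp.ext (funext fun k => ?_)
  by_cases hk : ∃ i, e i = k
  · obtain ⟨i, rfl⟩ := hk
    rw [diagonalOp_apply, extendLp_apply, extendLp_apply, diagonalOp_apply]
  · rw [diagonalOp_apply, extendLp_apply_of_notMem _ _ hk, extendLp_apply_of_notMem _ _ hk,
      map_zero]

theorem polyEval_diagonalOp {n : ℕ} (ι : Type) (p : MvPolynomial (Fin n) ℂ)
    (X : Fin n → E →L[ℂ] E) :
    polyEval p (fun i => diagonalOp ι (X i)) = diagonalOp ι (polyEval p X) := by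
  refine ContinuousLinearMap.ext fun a => lp.ext (funext fun k => ?_)
  let ev : lp (fun _ : ι => E) 2 →ₗ[ℂ] E :=
    { toFun := fun a => a k
      map_add' := fun _ _ => rfl
      map_smul' := fun _ _ => rfl }
  exact map_polyEval p ev (fun _ _ => rfl) a

/-- Multiplication by `A + z B` in terms of Taylor coefficients. -/
theorem taylor_eq_of_apply_eq {f g : HardySpace E} {A B : E →L[ℂ] E}
    (h : ∀ z : Disc, g z = A (f z) + (z : ℂ) • B (f z)) :
    HardySpace.taylor g = diagonalOp ℕ A (HardySpace.taylor f) +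
      extendLp (addRightEmbedding 1) (diagonalOp ℕ B (HardySpace.taylor f)) := by
  refine HardySpace.taylor_unique fun z => ?_
  have hA := (HardySpace.hasSum_taylor f z).mapL A
  have hB := ((HardySpace.hasSum_taylor f z).mapL B).const_smul (z : ℂ)
  simp only [map_smul] at hA hB
  set b := extendLp (addRightEmbedding 1) (diagonalOp ℕ B (HardySpace.taylor f)) with hb
  have hsucc : ∀ k, b (k + 1) = B (HardySpace.taylor f k) := fun k =>
    extendLp_apply (addRightEmbedding 1) (diagonalOp ℕ B (HardySpace.taylor f)) k
  have h0 : b 0 = 0 := extendLp_apply_of_notMem _ _ (by simp)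
  have hshift : HasSum (fun k : ℕ => (z : ℂ) ^ k • b k) ((z : ℂ) • B (f z)) := by
    have h1 : HasSum (fun k : ℕ => (z : ℂ) ^ (k + 1) • b (k + 1)) ((z : ℂ) • B (f z)) := by
      convert hB using 2 with k
      rw [hsucc, pow_succ', mul_smul]
    have h2 := (hasSum_nat_add_iff (f := fun k => (z : ℂ) ^ k • b k) 1).1 h1
    simpa [h0] using h2
  rw [h z]
  refine (hA.add hshift).congr_fun fun k => ?_
  rw [← smul_add]
  rfl

/-- The embedding `k ↦ k + c` of the integers. -/
def shiftIndex (c : ℤ) : ℤ ↪ ℤ := (Equiv.addRight c).toEmbedding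

variable (E) in
/-- The bilateral shift `(W a)ₖ = aₖ₋₁`. -/
def bilateralShift : lp (fun _ : ℤ => E) 2 →L[ℂ] lp (fun _ : ℤ => E) 2 :=
  (extendLp (shiftIndex 1)).toContinuousLinearMap

theorem commute_bilateralShift (A : E →L[ℂ] E) :
    Commute (bilateralShift E) (diagonalOp ℤ A) :=
  ContinuousLinearMap.ext fun a => (diagonalOp_extendLp A (shiftIndex 1) a).symm

variable [CompleteSpace E]

theorem star_bilateralShift_mul : star (bilateralShift E) * bilateralShift E = 1 :=
  (norm_map_iff_adjoint_comp_self _).1 fun a => (extendLp (shiftIndex 1)).norm_map a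

theorem bilateralShift_mul_star : bilateralShift E * star (bilateralShift E) = 1 := by
  let W' : lp (fun _ : ℤ => E) 2 →L[ℂ] lp (fun _ : ℤ => E) 2 :=
    (extendLp (shiftIndex (-1))).toContinuousLinearMap
  have h : bilateralShift E * W' = 1 := by
    refine ContinuousLinearMap.ext fun a => ?_
    change extendLp (shiftIndex 1) (extendLp (shiftIndex (-1)) a) = a
    rw [extendLp_extendLp]
    refine lp.ext (funext fun k => ?_)
    have hk : ((shiftIndex (-1)).trans (shiftIndex 1)) k = k := by simp [shiftIndex]
    conv_lhs => rw [← hk]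
    exact extendLp_apply _ _ _
  have h' : star (bilateralShift E) = W' := by
    rw [← mul_one (star _), ← h, ← mul_assoc, star_bilateralShift_mul, one_mul]
  rw [h', h]

end Sequences

/-! ### Characters and approximate eigenvectors -/

/-- If a character of a `C*`-algebra of operators vanishes at `G` and `F`, then `G` and `F` are not
jointly bounded below: otherwise `G* G + F* F`, at which the character vanishes, would be invertible,
and by spectral permanence its inverse would belong to the algebra. -/
theorem not_bounded_below_of_character_eq_zero {K : Type*} [NormedAddCommGroup K]
    [InnerProductSpace ℂ K] [CompleteSpace K] (B : StarSubalgebra ℂ (K →L[ℂ] K))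
    [IsClosed (B : Set (K →L[ℂ] K))] (χ : B →ₐ[ℂ] ℂ) {G F : B} (hG : χ G = 0) (hF : χ F = 0)
    {δ r : ℝ} (hδ : 0 < δ)
    (h : ∀ x : K, δ * ‖x‖ ≤ ‖(G : K →L[ℂ] K) x‖ + r * ‖(F : K →L[ℂ] K) x‖) : False := by
  set Y : B := star G * G + star F * F with hY
  have hχ : χ Y = 0 := by rw [hY, map_add, map_mul, map_mul, hG, hF]; simp
  have hcpos : 0 < δ ^ 2 / (1 + r ^ 2) := by positivity
  have hunit : IsUnit (Y : K →L[ℂ] K) := by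
    refine isUnit_of_forall_le_norm_inner_map _ (c := ⟨δ ^ 2 / (1 + r ^ 2), hcpos.le⟩) hcpos
      fun x => ?_
    have h1 : inner ℂ ((Y : K →L[ℂ] K) x) x =
        ((‖(G : K →L[ℂ] K) x‖ ^ 2 + ‖(F : K →L[ℂ] K) x‖ ^ 2 : ℝ) : ℂ) := by
      have h2 : (Y : K →L[ℂ] K) x = adjoint (G : K →L[ℂ] K) ((G : K →L[ℂ] K) x) +
        adjoint (F : K →L[ℂ] K) ((F : K →L[ℂ] K) x) := rfl
      rw [h2, inner_add_left, adjoint_inner_left, adjoint_inner_left,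
        inner_self_eq_norm_sq_to_K, inner_self_eq_norm_sq_to_K]
      push_cast
      rfl
    rw [h1, Complex.norm_real, Real.norm_of_nonneg (by positivity)]
    change ‖x‖ ^ 2 * (δ ^ 2 / (1 + r ^ 2)) ≤ _
    rw [← mul_div_assoc, div_le_iff₀ (by positivity)]
    have h3 : (δ * ‖x‖) ^ 2 ≤ (‖(G : K →L[ℂ] K) x‖ + r * ‖(F : K →L[ℂ] K) x‖) ^ 2 :=
      pow_le_pow_left₀ (by positivity) (h x) 2
    nlinarith [sq_nonneg (r * ‖(G : K →L[ℂ] K) x‖ - ‖(F : K →L[ℂ] K) x‖)]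
  have := ((StarSubalgebra.coe_isUnit B).1 hunit).map χ
  rw [hχ] at this
  exact not_isUnit_zero this

/-- Let `χ` be a character with `χ F = 0`, and let the tuple `X` agree with `s` modulo the left
ideal generated by `F`. Then `|p(χ(s))| ≤ ‖p(X)‖`: otherwise `p(s) - p(χ(s))` and `F`, at which `χ`
vanishes, would be jointly bounded below. -/
theorem norm_eval_character_le {K : Type*} [NormedAddCommGroup K] [InnerProductSpace ℂ K]
    [CompleteSpace K] (B : StarSubalgebra ℂ (K →L[ℂ] K)) [IsClosed (B : Set (K →L[ℂ] K))]
    (χ : B →ₐ[ℂ] ℂ) {n : ℕ} (s : Fin n → B) {F : B} (hF : χ F = 0)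
    (hcomm : ∀ i, Commute (F : K →L[ℂ] K) (s i)) {X : Fin n → K →L[ℂ] K}
    (hX : ∀ i, ∃ R, X i - (s i : K →L[ℂ] K) = R * (F : K →L[ℂ] K))
    (p : MvPolynomial (Fin n) ℂ) :
    ‖MvPolynomial.eval (fun i => χ (s i)) p‖ ≤ ‖polyEval p X‖ := by
  by_contra! hlt
  set μ := MvPolynomial.eval (fun i => χ (s i)) p
  obtain ⟨b, hb, hχ⟩ := exists_coe_eq_polyEval B s p
  obtain ⟨R, hR⟩ := exists_polyEval_sub_eq_mul p hcomm hX
  refine not_bounded_below_of_character_eq_zero B χ (G := b - algebraMap ℂ B μ) (F := F) ?_ hF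
    (δ := ‖μ‖ - ‖polyEval p X‖) (r := ‖R‖) (by linarith) fun x => ?_
  · rw [map_sub, AlgHomClass.commutes, hχ]
    exact sub_self _
  · have h1 : polyEval p X x - (b : K →L[ℂ] K) x = R ((F : K →L[ℂ] K) x) := by
      rw [hb]
      exact congrArg (fun T : K →L[ℂ] K => T x) hR
    have h2 : ((b - algebraMap ℂ B μ : B) : K →L[ℂ] K) x = (b : K →L[ℂ] K) x - μ • x := rfl
    rw [h2]
    have h3 : μ • x = polyEval p X x - R ((F : K →L[ℂ] K) x) - ((b : K →L[ℂ] K) x - μ • x) := by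
      rw [← h1]
      abel
    have h4 := congrArg norm h3
    rw [norm_smul] at h4
    have h5 := norm_sub_le (polyEval p X x - R ((F : K →L[ℂ] K) x)) ((b : K →L[ℂ] K) x - μ • x)
    have h6 := norm_sub_le (polyEval p X x) (R ((F : K →L[ℂ] K) x))
    have h7 := (polyEval p X).le_opNorm x
    have h8 := R.le_opNorm ((F : K →L[ℂ] K) x)
    linarith

/-! ### The `Γ_n`-unitary extension of the model -/

section Extension

variable {E : Type u} [NormedAddCommGroup E] [InnerProductSpace ℂ E] [CompleteSpace E]

/-- The tuple of the Laurent operators on `ℓ²(ℤ, E)` with symbols `Φᵢ(z)` and `z`. -/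
def laurentTuple {n : ℕ} (A : Fin n → E →L[ℂ] E) :
    Fin (n + 1) → lp (fun _ : ℤ => E) 2 →L[ℂ] lp (fun _ : ℤ => E) 2 :=
  Fin.snoc (α := fun _ => lp (fun _ : ℤ => E) 2 →L[ℂ] lp (fun _ : ℤ => E) 2)
    (fun i => diagonalOp ℤ (A i) + bilateralShift E * diagonalOp ℤ (adjoint (A i.rev)))
    (bilateralShift E)

variable {n : ℕ} {A : Fin n → E →L[ℂ] E}

theorem laurentTuple_castSucc (A : Fin n → E →L[ℂ] E) (i : Fin n) : laurentTuple A i.castSucc =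
    diagonalOp ℤ (A i) + bilateralShift E * diagonalOp ℤ (adjoint (A i.rev)) :=
  Fin.snoc_castSucc (α := fun _ => lp (fun _ : ℤ => E) 2 →L[ℂ] lp (fun _ : ℤ => E) 2) _ _ _

theorem laurentTuple_last (A : Fin n → E →L[ℂ] E) :
    laurentTuple A (Fin.last n) = bilateralShift E :=
  Fin.snoc_last (α := fun _ => lp (fun _ : ℤ => E) 2 →L[ℂ] lp (fun _ : ℤ => E) 2) _ _

theorem commute_bilateralShift_laurentTuple (A : Fin n → E →L[ℂ] E) (i : Fin (n + 1)) :
    Commute (bilateralShift E) (laurentTuple A i) := by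
  refine Fin.lastCases ?_ (fun i => ?_) i
  · rw [laurentTuple_last]
  · rw [laurentTuple_castSucc]
    exact (commute_bilateralShift _).add_right
      ((Commute.refl _).mul_right (commute_bilateralShift _))

theorem commute_laurentTuple (h1 : ∀ i j, A i * A j - A j * A i = 0)
    (h2 : ∀ i j, A i * adjoint (A j.rev) - adjoint (A j.rev) * A i =
      A j * adjoint (A i.rev) - adjoint (A i.rev) * A j) (i j : Fin (n + 1)) :
    Commute (laurentTuple A i) (laurentTuple A j) := by
  refine Fin.lastCases ?_ (fun i => ?_) i
  · rw [laurentTuple_last]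
    exact commute_bilateralShift_laurentTuple A j
  refine Fin.lastCases ?_ (fun j => ?_) j
  · rw [laurentTuple_last]
    exact (commute_bilateralShift_laurentTuple A _).symm
  rw [laurentTuple_castSucc, laurentTuple_castSucc]
  have hd : ∀ A : E →L[ℂ] E, diagonalOp ℤ A = diagonalHom ℤ A := fun _ => rfl
  refine commute_pencil ?_ ?_ ?_ (commute_bilateralShift _) (commute_bilateralShift _)
    (commute_bilateralShift _) (commute_bilateralShift _)
  · rw [hd, hd, ← map_mul, ← map_mul, ← map_sub, h1, map_zero]
  · have hc : Commute (A i.rev) (A j.rev) := sub_eq_zero.1 (h1 _ _)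
    exact hc.star_star.map (diagonalHom ℤ)
  · simp only [hd, ← map_mul, ← map_sub, h2]

theorem laurentTuple_castSucc_eq (A : Fin n → E →L[ℂ] E) (i : Fin n) :
    laurentTuple A i.castSucc =
      star (laurentTuple A i.rev.castSucc) * laurentTuple A (Fin.last n) := by
  rw [laurentTuple_last, laurentTuple_castSucc, laurentTuple_castSucc, star_add, star_mul,
    add_mul, mul_assoc, star_bilateralShift_mul, mul_one, star_eq_adjoint, star_eq_adjoint,
    adjoint_diagonalOp, adjoint_diagonalOp, adjoint_adjoint, Fin.rev_rev, add_comm,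
    (commute_bilateralShift _).eq]

theorem isStarNormal_laurentTuple (h1 : ∀ i j, A i * A j - A j * A i = 0)
    (h2 : ∀ i j, A i * adjoint (A j.rev) - adjoint (A j.rev) * A i =
      A j * adjoint (A i.rev) - adjoint (A i.rev) * A j) (i : Fin (n + 1)) :
    IsStarNormal (laurentTuple A i) := by
  refine Fin.lastCases ?_ (fun i => ?_) i
  · rw [laurentTuple_last]
    exact ⟨star_bilateralShift_mul.trans bilateralShift_mul_star.symm⟩
  · refine ⟨?_⟩
    have hs : star (laurentTuple A i.castSucc) =
        star (bilateralShift E) * laurentTuple A i.rev.castSucc := by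
      conv_lhs => rw [laurentTuple_castSucc_eq, star_mul, star_star, laurentTuple_last]
    have hc : Commute (star (bilateralShift E)) (laurentTuple A i.castSucc) := by
      set W := bilateralShift E
      set T := laurentTuple A i.castSucc
      have hWT : W * T = T * W := (commute_bilateralShift_laurentTuple A i.castSucc).eq
      calc star W * T = star W * (T * W) * star W := by
            rw [mul_assoc, mul_assoc, bilateralShift_mul_star, mul_one]
        _ = star W * W * T * star W := by rw [← hWT, ← mul_assoc]
        _ = T * star W := by rw [star_bilateralShift_mul, one_mul]
    rw [hs]
    exact hc.mul_left (commute_laurentTuple h1 h2 _ _)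

theorem exists_diagonalOp_sub_laurentTuple_eq (A : Fin n → E →L[ℂ] E) (i : Fin n) (c z : ℂ) :
    ∃ R, diagonalOp ℤ (c • symbol A i z) - c • laurentTuple A i.castSucc =
      R * (bilateralShift E - z • 1) := by
  refine ⟨-(c • diagonalOp ℤ (adjoint (A i.rev))), ?_⟩
  have hadd : diagonalOp ℤ (symbol A i z) =
    diagonalOp ℤ (A i) + z • diagonalOp ℤ (adjoint (A i.rev)) := rfl
  rw [diagonalOp_smul, hadd, laurentTuple_castSucc, (commute_bilateralShift _).eq, mul_sub,
    mul_smul_comm, mul_one, neg_mul, smul_mul_assoc]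
  module

/-- For a character `χ` of the `C*`-algebra of the Laurent operators, with `χ(W) = z`, the operators
`Tᵢ` and `1 ⊗ Φᵢ(z)` agree modulo `W - z`. Hence `|p(γ χ(T))| ≤ ‖p(γ Φ(z))‖` for all
polynomials `p`, and `γ χ(T)` belongs to `Γ_n` by polynomial convexity. -/
theorem derivCoords_character_mem_Gamma
    (hΓ : ∀ z : ℂ, ‖z‖ = 1 → ∀ p : MvPolynomial (Fin n) ℂ,
      ‖polyEval p (fun i => (((n : ℂ) - (i : ℕ)) / ((n : ℂ) + 1)) • symbol A i z)‖ ≤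
        sSup ((fun z => ‖MvPolynomial.eval z p‖) '' Gamma n))
    (χ : WeakDual.characterSpace ℂ (cstar (laurentTuple A)))
    (hz : ‖χ ⟨laurentTuple A (Fin.last n), mem_cstar _ _⟩‖ = 1) :
    derivCoords (fun i => χ ⟨laurentTuple A i, mem_cstar _ i⟩) ∈ Gamma n := by
  refine mem_Gamma_of_forall_norm_eval_le fun p => ?_
  let t : Fin (n + 1) → cstar (laurentTuple A) := fun i => ⟨laurentTuple A i, mem_cstar _ i⟩
  let s : Fin n → cstar (laurentTuple A) := fun i =>
    (((n : ℂ) - (i : ℕ)) / ((n : ℂ) + 1)) • t i.castSucc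
  set z : ℂ := χ (t (Fin.last n))
  have hFcoe : ((t (Fin.last n) - algebraMap ℂ _ z : cstar (laurentTuple A)) :
      lp (fun _ : ℤ => E) 2 →L[ℂ] lp (fun _ : ℤ => E) 2) = bilateralShift E - z • 1 := by
    change laurentTuple A (Fin.last n) - algebraMap ℂ _ z = _
    rw [laurentTuple_last, Algebra.algebraMap_eq_smul_one]
  have hs : derivCoords (fun i => χ ⟨laurentTuple A i, mem_cstar _ i⟩) =
      fun i => WeakDual.CharacterSpace.toAlgHom χ (s i) :=
    funext fun i => (map_smul χ _ (t i.castSucc)).symm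
  have hχF : WeakDual.CharacterSpace.toAlgHom χ
      (t (Fin.last n) - algebraMap ℂ _ z : cstar (laurentTuple A)) = 0 := by
    rw [map_sub, AlgHomClass.commutes]
    exact sub_self _
  have hle := norm_eval_character_le (cstar (laurentTuple A))
    (WeakDual.CharacterSpace.toAlgHom χ) s hχF
    (X := fun i => diagonalOp ℤ ((((n : ℂ) - (i : ℕ)) / ((n : ℂ) + 1)) • symbol A i z))
    (fun i => by
      rw [hFcoe]
      exact ((commute_bilateralShift_laurentTuple A i.castSucc).sub_left
        ((Commute.one_left _).smul_left z)).smul_right _)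
    (fun i => by
      rw [hFcoe]
      exact exists_diagonalOp_sub_laurentTuple_eq A i _ z) p
  rw [hs]
  refine hle.trans ?_
  rw [polyEval_diagonalOp]
  exact (norm_diagonalOp_le _).trans (hΓ z hz p)

theorem isGammaUnitary_laurentTuple (h1 : ∀ i j, A i * A j - A j * A i = 0)
    (h2 : ∀ i j, A i * adjoint (A j.rev) - adjoint (A j.rev) * A i =
      A j * adjoint (A i.rev) - adjoint (A i.rev) * A j)
    (hΓ : ∀ z : ℂ, ‖z‖ = 1 → ∀ p : MvPolynomial (Fin n) ℂ,
      ‖polyEval p (fun i => (((n : ℂ) - (i : ℕ)) / ((n : ℂ) + 1)) • symbol A i z)‖ ≤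
        sSup ((fun z => ‖MvPolynomial.eval z p‖) '' Gamma n)) :
    IsGammaUnitary (laurentTuple A) := by
  refine ⟨commute_laurentTuple h1 h2, isStarNormal_laurentTuple h1 h2, ?_⟩
  rintro w ⟨χ, hχ⟩
  obtain rfl : (fun i => χ ⟨laurentTuple A i, mem_cstar _ i⟩) = w := funext hχ
  let t : Fin (n + 1) → cstar (laurentTuple A) := fun i => ⟨laurentTuple A i, mem_cstar _ i⟩
  have hlast : ‖χ (t (Fin.last n))‖ = 1 := by
    have h3 : star (t (Fin.last n)) * t (Fin.last n) = 1 := by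
      refine Subtype.ext ?_
      change star (laurentTuple A (Fin.last n)) * laurentTuple A (Fin.last n) = 1
      rw [laurentTuple_last, star_bilateralShift_mul]
    have h4 := congrArg (fun x => ‖χ x‖) h3
    simp only [map_mul, map_star, map_one, norm_mul, norm_star, norm_one] at h4
    nlinarith [norm_nonneg (χ (t (Fin.last n)))]
  rw [distinguishedBoundary_eq]
  refine mem_symmetrization_torus hlast (fun i => ?_) (derivCoords_character_mem_Gamma hΓ χ hlast)
  have h3 : t i.castSucc = star (t i.rev.castSucc) * t (Fin.last n) :=
    Subtype.ext (laurentTuple_castSucc_eq A i)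
  have h4 := congrArg χ h3
  rwa [map_mul, map_star] at h4

variable {H : Type u} [NormedAddCommGroup H] [InnerProductSpace ℂ H]

theorem isPureIsometry_of_isMulOperator {F : Type u} [NormedAddCommGroup F]
    [InnerProductSpace ℂ F] {V : H →L[ℂ] H} (U : H ≃ₗᵢ[ℂ] HardySpace F)
    (hV : IsMulOperator (conjBy U V) (fun z => z • ContinuousLinearMap.id ℂ F)) :
    IsPureIsometry V := by
  have hVU : ∀ (x : H) (z : Disc), U (V x) z = (z : ℂ) • U x z := fun x z => by
    have := hV (U x) z
    change U (V (U.symm (U x))) z = _ at this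
    rwa [U.symm_apply_apply] at this
  have htaylor : ∀ x, HardySpace.taylor (U (V x)) =
      extendLp (addRightEmbedding 1) (HardySpace.taylor (U x)) := fun x => by
    rw [taylor_eq_of_apply_eq (f := U x) (A := 0) (B := 1) fun z => by
      rw [hVU, zero_apply, zero_add]
      rfl]
    exact zero_add _
  refine ⟨(AddMonoidHomClass.isometry_iff_norm V).2 fun x => ?_, ?_⟩
  · rw [← U.norm_map, HardySpace.norm_eq, htaylor, LinearIsometry.norm_map, ← HardySpace.norm_eq,
      U.norm_map]
  · rw [Submodule.eq_bot_iff]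
    intro x hx
    have hzero : ∀ (k : ℕ) (y : H) (j : ℕ), j < k → HardySpace.taylor (U ((V ^ k) y)) j = 0 := by
      intro k
      induction k with
      | zero => intro y j hj; omega
      | succ k ih =>
        intro y j hj
        rw [pow_succ', mul_apply_eq_comp, htaylor]
        cases j with
        | zero => exact extendLp_apply_of_notMem _ _ (by simp)
        | succ j =>
          exact (extendLp_apply (addRightEmbedding 1) _ j).trans (ih y j (by omega))
    have hx0 : HardySpace.taylor (U x) = 0 := by
      refine lp.ext (funext fun j => ?_)
      obtain ⟨y, hy⟩ := Submodule.mem_iInf _ |>.1 hx (j + 1)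
      have := hzero (j + 1) y j j.lt_succ_self
      rwa [show (V ^ (j + 1)) y = x from hy] at this
    rw [← norm_eq_zero, ← U.norm_map, HardySpace.norm_eq, hx0, norm_zero]

/-- The Taylor coefficients, extended by zero to `ℓ²(ℤ, E)`, embed `H` into the space of the
`Γ_n`-unitary of Laurent operators, which extends the given tuple. -/
theorem isGammaIsometry_of_isMulOperator {S : Fin (n + 1) → H →L[ℂ] H}
    (U : H ≃ₗᵢ[ℂ] HardySpace E)
    (hS : ∀ i : Fin n, IsMulOperator (conjBy U (S i.castSucc)) (symbol A i))
    (hlast : IsMulOperator (conjBy U (S (Fin.last n))) (fun z => z • ContinuousLinearMap.id ℂ E))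
    (hT : IsGammaUnitary (laurentTuple A)) : IsGammaIsometry S := by
  let c : ℕ ↪ ℤ := Nat.castEmbedding
  let J : H →ₗᵢ[ℂ] lp (fun _ : ℤ => E) 2 :=
    (extendLp c).comp ((U.trans (HardySpace.taylorEquiv E)).toLinearIsometry)
  have hJ : ∀ x, J x = extendLp c (HardySpace.taylor (U x)) := fun x => rfl
  have key : ∀ (B C : E →L[ℂ] E) (x y : H),
      (∀ z : Disc, U y z = B (U x z) + (z : ℂ) • C (U x z)) →
      J y = (diagonalOp ℤ B + bilateralShift E * diagonalOp ℤ C) (J x) := by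
    intro B C x y h
    have hc : (addRightEmbedding 1 : ℕ ↪ ℕ).trans c = c.trans (shiftIndex 1) := by
      ext k
      simp [c, shiftIndex]
    rw [hJ, hJ, taylor_eq_of_apply_eq h, map_add, extendLp_extendLp, hc, ← extendLp_extendLp,
      ← diagonalOp_extendLp, ← diagonalOp_extendLp]
    rfl
  refine ⟨lp (fun _ : ℤ => E) 2, inferInstance, inferInstance, inferInstance, J, laurentTuple A,
    hT, fun i x => ?_⟩
  refine Fin.lastCases ?_ (fun i => ?_) i
  · have h := key 0 1 x (S (Fin.last n) x) fun z => by
      have := hlast (U x) z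
      change U (S (Fin.last n) (U.symm (U x))) z = _ at this
      rw [U.symm_apply_apply] at this
      rw [this, zero_apply, zero_add]
      rfl
    rw [h, laurentTuple_last]
    have h0 : diagonalOp ℤ (0 : E →L[ℂ] E) + bilateralShift E * diagonalOp ℤ 1 =
        bilateralShift E := by
      rw [show diagonalOp ℤ (0 : E →L[ℂ] E) = 0 from rfl,
        show diagonalOp ℤ (1 : E →L[ℂ] E) = 1 from rfl, zero_add, mul_one]
    rw [h0]
  · rw [laurentTuple_castSucc]
    refine (key _ _ x (S i.castSucc x) fun z => ?_).symm
    have := hS i (U x) z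
    change U (S i.castSucc (U.symm (U x))) z = _ at this
    rw [U.symm_apply_apply] at this
    exact this

end Extension

theorem isPureGammaIsometry_of_model {n : ℕ} {H E : Type u} [NormedAddCommGroup H]
    [InnerProductSpace ℂ H] [NormedAddCommGroup E] [InnerProductSpace ℂ E] [CompleteSpace E]
    {S : Fin (n + 1) → H →L[ℂ] H} {A : Fin n → E →L[ℂ] E} (U : H ≃ₗᵢ[ℂ] HardySpace E)
    (hS : ∀ i : Fin n, IsMulOperator (conjBy U (S i.castSucc)) (symbol A i))
    (hlast : IsMulOperator (conjBy U (S (Fin.last n))) (fun z => z • ContinuousLinearMap.id ℂ E))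
    (hΓ : ∀ z : ℂ, ‖z‖ = 1 → IsGammaContraction
      (fun i : Fin n => (((n : ℂ) - (i : ℕ)) / ((n : ℂ) + 1)) • symbol A i z))
    (h1 : ∀ i j, A i * A j - A j * A i = 0)
    (h2 : ∀ i j, A i * adjoint (A j.rev) - adjoint (A j.rev) * A i =
      A j * adjoint (A i.rev) - adjoint (A i.rev) * A j) : IsPureGammaIsometry S :=
  ⟨isGammaIsometry_of_isMulOperator U hS hlast
    (isGammaUnitary_laurentTuple h1 h2 fun z hz => (hΓ z hz).2),
    isPureIsometry_of_isMulOperator U hlast⟩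

end

end SymmetrizedDisc

end

/-- Model of pure `Γ_{n+1}`-isometries. With zero-based indices `i : Fin n`, the operator `A_{(n+1)-i}`
is `A i.rev`, and the constant `γ_i = ((n+1)-i)/(n+1)` is `(n - i) / (n + 1)`. -/
theorem mainTheorem3 {H : Type u} [NormedAddCommGroup H] [InnerProductSpace ℂ H]
    [CompleteSpace H] [TopologicalSpace.SeparableSpace H] (n : ℕ)
    (S : Fin (n + 1) → H →L[ℂ] H) (hS : ∀ i j, Commute (S i) (S j)) :
    SymmetrizedDisc.IsPureGammaIsometry S ↔
      ∃ (E : Type u) (_ : NormedAddCommGroup E) (_ : InnerProductSpace ℂ E)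
        (_ : CompleteSpace E) (_ : TopologicalSpace.SeparableSpace E)
        (U : H ≃ₗᵢ[ℂ] SymmetrizedDisc.HardySpace E)
        (Φ : Fin n → ℂ → E →L[ℂ] E) (A : Fin n → E →L[ℂ] E),
        (∀ i, SymmetrizedDisc.InHInfty (Φ i)) ∧
        (∀ i : Fin n, SymmetrizedDisc.IsMulOperator (SymmetrizedDisc.conjBy U (S i.castSucc)) (Φ i)) ∧
        SymmetrizedDisc.IsMulOperator (SymmetrizedDisc.conjBy U (S (Fin.last n)))
          (fun z => z • ContinuousLinearMap.id ℂ E) ∧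
        (∀ z : ℂ, ‖z‖ = 1 →
          SymmetrizedDisc.IsGammaContraction
            (fun i : Fin n => (((n : ℂ) - (i : ℕ)) / ((n : ℂ) + 1)) • Φ i z)) ∧
        (∀ (i : Fin n) (z : ℂ), ‖z‖ ≤ 1 →
          Φ i z = A i + z • ContinuousLinearMap.adjoint (A i.rev)) ∧
        (∀ i j : Fin n, A i * A j - A j * A i = 0) ∧
        (∀ i j : Fin n,
          A i * ContinuousLinearMap.adjoint (A j.rev) - ContinuousLinearMap.adjoint (A j.rev) * A i =
            A j * ContinuousLinearMap.adjoint (A i.rev) -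
              ContinuousLinearMap.adjoint (A i.rev) * A j) := by
  constructor
  · exact SymmetrizedDisc.exists_model_of_isPureGammaIsometry hS
  · rintro ⟨E, _, _, _, _, U, Φ, A, -, hmul, hlast, hΓ, hΦ, h1, h2⟩
    refine SymmetrizedDisc.isPureGammaIsometry_of_model (A := A) U (fun i f z => ?_) hlast
      (fun z hz => ?_) h1 h2
    · rw [hmul i f z, hΦ i z (mem_ball_zero_iff.1 z.2).le]
      rfl
    · have := hΓ z hz
      simp only [fun i => hΦ i z hz.le] at this
      exact this
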